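/- **Definitions.** An instance $\Gamma$ of 2CSP consists of a finite simple undirected graph $G=(V,E)$, a finite nonempty alphabet $\Sigma$, and for each edge $\{u,v\}\in E$ a constraint $C_{uv}\subseteq\Sigma\times\Sigma$. For an assignment $\psi:V\to\Sigma$, $\mathrm{val}(\psi)$ is the fraction of edges $\{u,v\}$ with $(\psi(u),\psi(v))\in C_{uv}$ (and $1$ if $E=\emptyset$), and $\mathrm{val}(\Gamma)=\max_\psi \mathrm{val}(\psi)$. For $\varepsilon\ge 0$, $\varepsilon$-Gap 2CSP is the promise problem, with parameter $k=|V|$, of distinguishing $\mathrm{val}(\Gamma)=1$ from $\mathrm{val}(\Gamma)<1-\varepsilon$; the graph and the constraints are given explicitly as a bit string. For a 3CNF formula $\varphi$, $\mathrm{sat}(\varphi)$ is the maximum fraction of simultaneously satisfiable clauses ($1$ if there are no clauses). A randomized algorithm solves a promise problem if on every YES (resp. NO) input it answers YES (resp. NO) with probability at least $2/3$; its running time is bounded on every outcome of its coin tosses. *Randomized Gap-ETH*: there are constants $\varepsilon,\delta>0$ and $C$ such that no randomized algorithm that, on 3CNF formulas $\varphi$ with $n$ variables and at most $Cn$ clauses,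 distinguishes $\mathrm{sat}(\varphi)=1$ from $\mathrm{sat}(\varphi)<1-\varepsilon$ runs in time $O(2^{\delta n})$ on all such formulas. *PIH*: there is $\varepsilon>0$ such that no randomized algorithm solves $\varepsilon$-Gap 2CSP and runs on every input $(x,k)\in\{0,1\}^*\times\mathbb N$ in time at most $f(k)\,(|x|+1)^c$ for some computable function $f$ and some constant $c$. **Statement.** Assume randomized Gap-ETH. Then there exists $\varepsilon>0$ such that, for every computable function $T:\mathbb N\to\mathbb N$ and every function $g:\mathbb N\to\mathbb R$ with $g(k)=o(k)$ as $k\to\infty$, no randomized algorithm solves $\varepsilon$-Gap 2CSP in time at most $T(k)\cdot|\Sigma|^{g(k)}$ on all instances with $|V|=k$ and alphabet $\Sigma$. Moreover, PIH holds. -/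

import Mathlib

open scoped NNReal ENNReal

namespace GapPIH

/-! ## Randomized algorithms with a step count

The machine model is the cons-cell (pointer) machine: finitely many registers, each holding a
pointer to an immutable binary cell structure, a structured finite program, fair coin tosses, and
unit cost for each elementary operation and each test.  Such a machine and a probabilistic
multi-tape Turing machine simulate each other with polynomial overhead (after `t` steps there are
at most `t` new cells, and the only test is a comparison with `nil`), so the classes of running
times considered below do not depend on this choice. -/

/-- Contents of a register: `nil`, or a cell with a head and a tail. -/
inductive Data : Type
  | nil : Data
  | cons : Data → Data → Data

namespace Data

/-- Head of a cell; `nil` for `nil`. -/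
def hd : Data → Data
  | nil => nil
  | cons a _ => a

/-- Tail of a cell; `nil` for `nil`. -/
def tl : Data → Data
  | nil => nil
  | cons _ b => b

/-- The truth value of a register: `nil` is false, every cell is true. -/
def truth : Data → Bool
  | nil => false
  | cons _ _ => true

/-- A bit as data. -/
def ofBit : Bool → Data
  | false => nil
  | true => cons nil nil

/-- A bit string as data: the linked list of its bits. -/
def ofBits : List Bool → Data
  | [] => nil
  | b :: l => cons (ofBit b) (ofBits l)

end Data

/-- Programs; registers are named by natural numbers. -/
inductive Prog : Type
  /-- `x := nil` -/
  | setNil (x : ℕ)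
  /-- `x := y` -/
  | copy (x y : ℕ)
  /-- `x := cons y z` -/
  | cons (x y z : ℕ)
  /-- `x := hd y` -/
  | hd (x y : ℕ)
  /-- `x := tl y` -/
  | tl (x y : ℕ)
  /-- `x :=` a fresh fair coin toss -/
  | flip (x : ℕ)
  /-- `p; q` -/
  | seq (p q : Prog)
  /-- `if x then p else q` -/
  | ite (x : ℕ) (p q : Prog)
  /-- `while x do p` -/
  | loop (x : ℕ) (p : Prog)

/-- Contents of all registers. -/
abbrev Store : Type := ℕ → Data

/-- A configuration: the stack of program parts still to be executed, and the store.  The machine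
has halted when the first component is empty. -/
abbrev Config : Type := List Prog × Store

/-- One step of computation, as a probability distribution on the next configuration. -/
noncomputable def step : Config → PMF Config
  | ([], s) => PMF.pure ([], s)
  | (.setNil x :: K, s) => PMF.pure (K, Function.update s x Data.nil)
  | (.copy x y :: K, s) => PMF.pure (K, Function.update s x (s y))
  | (.cons x y z :: K, s) => PMF.pure (K, Function.update s x (Data.cons (s y) (s z)))
  | (.hd x y :: K, s) => PMF.pure (K, Function.update s x (s y).hd)
  | (.tl x y :: K, s) => PMF.pure (K, Function.update s x (s y).tl)
  | (.flip x :: K, s) =>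
      (PMF.uniformOfFintype Bool).map fun b => (K, Function.update s x (Data.ofBit b))
  | (.seq p q :: K, s) => PMF.pure (p :: q :: K, s)
  | (.ite x p q :: K, s) => PMF.pure (if (s x).truth then p :: K else q :: K, s)
  | (.loop x p :: K, s) => PMF.pure (if (s x).truth then p :: .loop x p :: K else K, s)

/-- The distribution of the configuration after `t` steps. -/
noncomputable def runFor : ℕ → Config → PMF Config
  | 0, c => PMF.pure c
  | t + 1, c => (step c).bind (runFor t)

/-- The initial configuration on an input `(x, k)`: register `0` holds the bit string `x`,
register `1` holds `k` in unary, and all the other registers hold `nil`. -/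
def init (p : Prog) (i : List Bool × ℕ) : Config :=
  ([p], fun r => if r = 0 then Data.ofBits i.1
    else if r = 1 then Data.ofBits (List.replicate i.2 true) else Data.nil)

/-- On input `i`, whatever the coin tosses, `p` halts after at most `B` steps. -/
def HaltsWithin (p : Prog) (i : List Bool × ℕ) (B : ℝ) : Prop :=
  ∃ t : ℕ, (t : ℝ) ≤ B ∧ ∀ c ∈ (runFor t (init p i)).support, c.1 = []

/-- The probability that, on input `i`, `p` halts with the answer `b` in register `0`.  (The
probability of having done so within `t` steps is monotone in `t`.) -/
noncomputable def prOut (p : Prog) (i : List Bool × ℕ) (b : Bool) : ℝ≥0∞ :=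
  ⨆ t : ℕ, (runFor t (init p i)).toOuterMeasure {c | c.1 = [] ∧ (c.2 0).truth = b}

/-! ## Parameterized promise problems -/

/-- A parameterized promise problem: a pair of disjoint parameterized languages. -/
structure ParamPromiseProblem where
  yes : Set (List Bool × ℕ)
  no : Set (List Bool × ℕ)
  disjoint : Disjoint yes no

/-- `p` answers correctly, with probability at least `2/3`, on every input satisfying the
promise. -/
def Solves (p : Prog) (P : ParamPromiseProblem) : Prop :=
  (∀ i ∈ P.yes, 2 / 3 ≤ prOut p i true) ∧ (∀ i ∈ P.no, 2 / 3 ≤ prOut p i false)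

/-- `p` is a randomized FPT algorithm for `P`.  (`|x| + 1` instead of `|x|` only matters for the
empty string, on which no machine can run in time `0`.) -/
def IsRandFPT (p : Prog) (P : ParamPromiseProblem) : Prop :=
  Solves p P ∧ ∃ (f : ℕ → ℕ) (c : ℕ), Computable f ∧
    ∀ (x : List Bool) (k : ℕ), HaltsWithin p (x, k) ((f k : ℝ) * ((x.length : ℝ) + 1) ^ c)

/-! ## Encodings -/

/-- The self-delimiting unary code `1^n 0`. -/
def unary (n : ℕ) : List Bool := List.replicate n true ++ [false]

theorem unary_append_inj {m n : ℕ} {r r' : List Bool} (h : unary m ++ r = unary n ++ r') :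
    m = n ∧ r = r' := by
  induction m generalizing n with
  | zero => cases n <;> simp_all [unary, List.replicate_succ]
  | succ m ih =>
    cases n with
    | zero => simp [unary, List.replicate_succ] at h
    | succ n =>
      have h' : unary m ++ r = unary n ++ r' := by
        simpa [unary, List.replicate_succ] using h
      have := ih h'
      exact ⟨by rw [this.1], this.2⟩

theorem flatMap_inj {α β : Type*} {f g : α → List β} {l : List α}
    (hlen : ∀ a, (f a).length = (g a).length) (h : l.flatMap f = l.flatMap g) :
    ∀ a ∈ l, f a = g a := by
  induction l with
  | nil => simp
  | cons a l ih =>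
    rw [List.flatMap_cons, List.flatMap_cons] at h
    have h' := List.append_inj h (hlen a)
    intro b hb
    rcases List.mem_cons.1 hb with rfl | hb
    · exact h'.1
    · exact ih h'.2 b hb

/-! ## 3CNF formulas -/

/-- A literal over `n` variables: a variable and a sign (`true` for the positive literal). -/
abbrev Literal (n : ℕ) : Type := Fin n × Bool

/-- A disjunction of three literals (repetitions allowed). -/
abbrev Clause (n : ℕ) : Type := Literal n × Literal n × Literal n

/-- A 3CNF formula with variables `0, …, numVars - 1`. -/
structure CNF3 where
  numVars : ℕ
  clauses : List (Clause numVars)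

namespace CNF3

/-- Does the assignment `a` make the literal `l` true? -/
def litTrue {n : ℕ} (a : Fin n → Bool) (l : Literal n) : Bool := a l.1 == l.2

/-- Does the assignment `a` satisfy the clause `c`? -/
def clauseTrue {n : ℕ} (a : Fin n → Bool) (c : Clause n) : Bool :=
  litTrue a c.1 || litTrue a c.2.1 || litTrue a c.2.2

/-- The fraction of clauses satisfied by `a` (`1` if there are no clauses). -/
noncomputable def satFrac (F : CNF3) (a : Fin F.numVars → Bool) : ℝ :=
  if F.clauses.length = 0 then 1
  else (F.clauses.countP (clauseTrue a) : ℝ) / (F.clauses.length : ℝ)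

/-- The maximum fraction of simultaneously satisfiable clauses. -/
noncomputable def sat (F : CNF3) : ℝ := ⨆ a : Fin F.numVars → Bool, F.satFrac a

def encodeLit {n : ℕ} (l : Literal n) : List Bool := l.2 :: unary l.1

def encodeClause {n : ℕ} (c : Clause n) : List Bool :=
  encodeLit c.1 ++ encodeLit c.2.1 ++ encodeLit c.2.2

/-- The code of a list of clauses: each clause is preceded by `1`, and the end is marked by `0`. -/
def encodeClauses {n : ℕ} : List (Clause n) → List Bool
  | [] => [false]
  | c :: l => true :: (encodeClause c ++ encodeClauses l)

/-- The bit string describing a formula. -/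
def encode (F : CNF3) : List Bool := unary F.numVars ++ encodeClauses F.clauses

/-- The input of an algorithm for 3SAT: the formula and its number of variables. -/
def input (F : CNF3) : List Bool × ℕ := (F.encode, F.numVars)

theorem encodeLit_append_inj {n : ℕ} {l l' : Literal n} {r r' : List Bool}
    (h : encodeLit l ++ r = encodeLit l' ++ r') : l = l' ∧ r = r' := by
  simp only [encodeLit, List.cons_append, List.cons.injEq] at h
  obtain ⟨h1, h2⟩ := h
  obtain ⟨h3, h4⟩ := unary_append_inj h2
  exact ⟨Prod.ext (Fin.ext h3) h1, h4⟩

theorem encodeClause_append_inj {n : ℕ} {c c' : Clause n} {r r' : List Bool}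
    (h : encodeClause c ++ r = encodeClause c' ++ r') : c = c' ∧ r = r' := by
  simp only [encodeClause, List.append_assoc] at h
  obtain ⟨h1, h⟩ := encodeLit_append_inj h
  obtain ⟨h2, h⟩ := encodeLit_append_inj h
  obtain ⟨h3, h⟩ := encodeLit_append_inj h
  exact ⟨Prod.ext h1 (Prod.ext h2 h3), h⟩

theorem encodeClauses_injective {n : ℕ} :
    Function.Injective (encodeClauses : List (Clause n) → List Bool) := by
  intro l
  induction l with
  | nil => intro l' h; cases l' <;> simp_all [encodeClauses]
  | cons c l ih =>
    intro l' h
    cases l' with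
    | nil => simp [encodeClauses] at h
    | cons c' l' =>
      simp only [encodeClauses, List.cons.injEq, true_and] at h
      obtain ⟨h1, h2⟩ := encodeClause_append_inj h
      rw [h1, ih h2]

theorem encode_injective : Function.Injective encode := by
  rintro ⟨n, l⟩ ⟨n', l'⟩ h
  obtain ⟨h1, h2⟩ := unary_append_inj h
  dsimp only at h1
  subst h1
  exact congrArg (CNF3.mk n) (encodeClauses_injective h2)

end CNF3

/-- The gap version of 3SAT, on formulas with `n` variables and at most `C * n` clauses:
distinguish `sat F = 1` from `sat F < 1 - ε`. -/
noncomputable def gap3SAT (ε : ℝ≥0) (C : ℕ) : ParamPromiseProblem where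
  yes := {i | ∃ F : CNF3, F.clauses.length ≤ C * F.numVars ∧ F.sat = 1 ∧ i = F.input}
  no := {i | ∃ F : CNF3, F.clauses.length ≤ C * F.numVars ∧ F.sat < 1 - (ε : ℝ) ∧ i = F.input}
  disjoint := by
    rw [Set.disjoint_left]
    rintro _ ⟨F, -, hF, rfl⟩ ⟨F', -, hF', h⟩
    have : F = F' := CNF3.encode_injective (congrArg Prod.fst h)
    subst this
    rw [hF] at hF'
    linarith [ε.coe_nonneg]

/-- The randomized Gap Exponential Time Hypothesis: for some `ε, δ > 0` (and some constant `C` in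
the `O(n)` bound on the number of clauses), no randomized algorithm that distinguishes
`sat F = 1` from `sat F < 1 - ε` with probability at least `2/3` runs in time `O(2 ^ (δ n))`. -/
def GapETH : Prop :=
  ∃ (ε : ℝ≥0) (δ : ℝ) (C : ℕ), 0 < ε ∧ 0 < δ ∧
    ¬ ∃ p : Prog, Solves p (gap3SAT ε C) ∧
      ∃ K : ℝ, ∀ F : CNF3, F.clauses.length ≤ C * F.numVars →
        HaltsWithin p F.input (K * (2 : ℝ) ^ (δ * (F.numVars : ℝ)))

/-! ## 2CSP -/

/-- A 2CSP instance with vertex set `Fin numVars` and nonempty alphabet `Fin alphSize`.  The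
constraint of an edge `{u, v}` is the set of pairs `(a, b)` with `con u v a b`; read from `v` to
`u` it is the transposed set.  The values of `con` at non-adjacent vertices play no role. -/
structure TwoCSP where
  numVars : ℕ
  alphSize : ℕ
  alphSize_pos : 0 < alphSize
  graph : SimpleGraph (Fin numVars)
  con : Fin numVars → Fin numVars → Fin alphSize → Fin alphSize → Bool
  con_symm : ∀ u v a b, con u v a b = con v u b a

namespace TwoCSP

/-- The assignment `ψ` satisfies the edge `e`. -/
def EdgeSat (I : TwoCSP) (ψ : Fin I.numVars → Fin I.alphSize) (e : Sym2 (Fin I.numVars)) : Prop :=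
  ∀ u v, e = s(u, v) → I.con u v (ψ u) (ψ v) = true

/-- The value of an assignment: the fraction of satisfied edges (`1` if there are no edges). -/
noncomputable def assignVal (I : TwoCSP) (ψ : Fin I.numVars → Fin I.alphSize) : ℝ :=
  if I.graph.edgeSet.ncard = 0 then 1
  else ({e ∈ I.graph.edgeSet | I.EdgeSat ψ e}.ncard : ℝ) / (I.graph.edgeSet.ncard : ℝ)

/-- The value of an instance: the maximum value of an assignment. -/
noncomputable def val (I : TwoCSP) : ℝ := ⨆ ψ : Fin I.numVars → Fin I.alphSize, I.assignVal ψ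

open Classical in
/-- The code of the pair `(u, v)`: a bit for adjacency and the table of `con u v`. -/
noncomputable def encodePair (I : TwoCSP) (u v : Fin I.numVars) : List Bool :=
  decide (I.graph.Adj u v) :: (List.finRange I.alphSize).flatMap fun a =>
    (List.finRange I.alphSize).flatMap fun b => [I.con u v a b]

/-- The bit string describing an instance: `|V|` and `|Σ|` in unary, then the explicit
description of the graph and of the constraints. -/
noncomputable def encode (I : TwoCSP) : List Bool :=
  unary I.numVars ++ (unary I.alphSize ++
    (List.finRange I.numVars).flatMap fun u =>
      (List.finRange I.numVars).flatMap fun v => I.encodePair u v)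

/-- The parameterized input: the instance, with parameter `|V|`. -/
noncomputable def input (I : TwoCSP) : List Bool × ℕ := (I.encode, I.numVars)

theorem encode_injective : Function.Injective encode := by
  rintro ⟨k, q, hq, G, R, hR⟩ ⟨k', q', hq', G', R', hR'⟩ h
  obtain ⟨h1, h⟩ := unary_append_inj h
  dsimp only at h1
  subst h1
  obtain ⟨h2, h⟩ := unary_append_inj h
  dsimp only at h2
  subst h2
  have hp := fun u => flatMap_inj (by simp [encodePair]) h u (List.mem_finRange u)
  have hp2 := fun u v => flatMap_inj (by simp [encodePair]) (hp u) v (List.mem_finRange v)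
  have hG : G = G' := by
    ext u v
    have := hp2 u v
    simp only [encodePair, List.cons.injEq, decide_eq_decide] at this
    exact this.1
  have hR : R = R' := by
    funext u v a b
    have := hp2 u v
    simp only [encodePair, List.cons.injEq] at this
    have h3 := flatMap_inj (by simp) this.2 a (List.mem_finRange a)
    have h4 := flatMap_inj (by simp) h3 b (List.mem_finRange b)
    simpa using h4
  subst hG hR
  rfl

end TwoCSP

/-- The parameterized promise problem `ε`-Gap 2CSP: distinguish `val I = 1` from
`val I < 1 - ε`; the parameter is the number of vertices. -/
noncomputable def gap2CSP (ε : ℝ≥0) : ParamPromiseProblem where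
  yes := {i | ∃ I : TwoCSP, I.val = 1 ∧ i = I.input}
  no := {i | ∃ I : TwoCSP, I.val < 1 - (ε : ℝ) ∧ i = I.input}
  disjoint := by
    rw [Set.disjoint_left]
    rintro _ ⟨I, hI, rfl⟩ ⟨I', hI', h⟩
    have : I = I' := TwoCSP.encode_injective (congrArg Prod.fst h)
    subst this
    rw [hI] at hI'
    linarith [ε.coe_nonneg]

/-- The Parameterized Inapproximability Hypothesis. -/
def PIH : Prop := ∃ ε : ℝ≥0, 0 < ε ∧ ¬ ∃ p : Prog, IsRandFPT p (gap2CSP ε)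

end GapPIH

namespace GapPIH

/-! ## Deterministic execution -/

/-! The gap is already present in Gap-3SAT, so it suffices to compress formulas into few vertices
without losing more than a constant factor of it. Fix a constant ℓ. A formula with n variables and m
≤ Cn clauses becomes a 2CSP on the complete bipartite graph with ℓ vertices on each side: one side
carries blocks of clauses, the other groups of variables, and a letter is a bit string assigning
values to the variables stored at its vertex. An edge checks that the clauses of the block are
satisfied and that both letters agree on common variables. Strings of length about 3m/ℓ suffice, so
an algorithm with running time T(k)·|Σ|^g(k) on k = 2ℓ vertices takes time T(2ℓ)·2^(O(g(2ℓ)/ℓ)·n) up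
to a constant factor; T(2ℓ) is a constant, and since g = o(k) the exponent drops below δn for a
suitable ℓ.

Soundness requires that no edge carries much more than its share of about 3m/ℓ² occurrences of
variables, for otherwise a few violated edges could hide many violated clauses. This is achieved
deterministically. The occurrences, sorted by variable, are cut into ℓ intervals; a variable lying
in one interval is light and belongs to that group. At most ℓ variables straddle a cut; these heavy
variables are stored at every group vertex. The clauses are then classified by the groups of their
three variables, and each of the (ℓ+1)³ classes is dealt out to the blocks in rotation, so that
every statistic depending only on the class is balanced among the blocks (`mul_sum_block_le`,
`mul_sum_typeCount_block_le`). The rounding errors depend on ℓ only and are at most m once short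
formulas have been repeated. Reading light variables at their own group and heavy ones at the group
with the fewest violated edges gives ℓ²·(violated clauses) ≤ 7m·(violated edges), which is
`exists_few_violated`; hence a gap ε becomes ε/8.

The reduction must be run by the given machine model. A small calculus of polynomial-time functions
yields `polyTimeIn_reduction`: the time is polynomial in the input size plus the alphabet size, and
its degree is again absorbed by the choice of ℓ (`not_solves_gap2CSP`). PIH follows because an
instance with k vertices has a code of length O(k²·|Σ|²), so an FPT running time has the form
T(k)·|Σ|^g(k) with g constant. -/

theorem runFor_add (a b : ℕ) (c : Config) :
    runFor (a + b) c = (runFor a c).bind (runFor b) := by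
  induction a generalizing c with
  | zero => simp [runFor]
  | succ a ih =>
    rw [show a + 1 + b = a + b + 1 by omega]
    simp only [runFor, PMF.bind_bind]
    congr 1
    funext c'
    exact ih c'

/-- The program `p` deterministically leads from the store `s` to the store `s'` in `t` steps. -/
def Exec (p : Prog) (s s' : Store) (t : ℕ) : Prop :=
  ∀ K : List Prog, runFor t (p :: K, s) = PMF.pure (K, s')

namespace Exec

theorem of_step {p : Prog} {s s' : Store}
    (h : ∀ K : List Prog, step (p :: K, s) = PMF.pure (K, s')) : Exec p s s' 1 := by
  intro K
  simp only [runFor, h, PMF.pure_bind]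

theorem setNil (x : ℕ) (s : Store) : Exec (.setNil x) s (Function.update s x Data.nil) 1 :=
  of_step fun _ => rfl

theorem copy (x y : ℕ) (s : Store) : Exec (.copy x y) s (Function.update s x (s y)) 1 :=
  of_step fun _ => rfl

theorem cons (x y z : ℕ) (s : Store) :
    Exec (.cons x y z) s (Function.update s x (Data.cons (s y) (s z))) 1 :=
  of_step fun _ => rfl

theorem hd (x y : ℕ) (s : Store) : Exec (.hd x y) s (Function.update s x (s y).hd) 1 :=
  of_step fun _ => rfl

theorem tl (x y : ℕ) (s : Store) : Exec (.tl x y) s (Function.update s x (s y).tl) 1 :=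
  of_step fun _ => rfl

/-- Composition works because `Exec` quantifies over every continuation stack: the first program is
run with the second one on top of the stack. -/
theorem seq {p q : Prog} {s s₁ s₂ : Store} {t₁ t₂ : ℕ} (h₁ : Exec p s s₁ t₁)
    (h₂ : Exec q s₁ s₂ t₂) : Exec (.seq p q) s s₂ (1 + (t₁ + t₂)) := by
  intro K
  have h0 : runFor 1 (.seq p q :: K, s) = PMF.pure (p :: q :: K, s) := by
    simp only [runFor, step, PMF.pure_bind]
  rw [runFor_add, h0, PMF.pure_bind, runFor_add, h₁, PMF.pure_bind, h₂]

theorem ite {x : ℕ} {p q : Prog} {s s' : Store} {t : ℕ}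
    (h : Exec (if (s x).truth then p else q) s s' t) : Exec (.ite x p q) s s' (1 + t) := by
  intro K
  have h0 : runFor 1 (.ite x p q :: K, s) =
      PMF.pure ((if (s x).truth then p else q) :: K, s) := by
    simp only [runFor, step, PMF.pure_bind]
    split <;> rfl
  rw [runFor_add, h0, PMF.pure_bind, h]

theorem loop_false {x : ℕ} {p : Prog} {s : Store} (hx : (s x).truth = false) :
    Exec (.loop x p) s s 1 :=
  of_step fun _ => by simp [step, hx]

theorem loop_true {x : ℕ} {p : Prog} {s s₁ s₂ : Store} {t₁ t₂ : ℕ} (hx : (s x).truth = true)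
    (h₁ : Exec p s s₁ t₁) (h₂ : Exec (.loop x p) s₁ s₂ t₂) :
    Exec (.loop x p) s s₂ (1 + (t₁ + t₂)) := by
  intro K
  have h0 : runFor 1 (.loop x p :: K, s) = PMF.pure (p :: .loop x p :: K, s) := by
    simp only [runFor, step, PMF.pure_bind, hx, if_true]
  rw [runFor_add, h0, PMF.pure_bind, runFor_add, h₁, PMF.pure_bind, h₂]

end Exec

/-! ### A calculus of programs acting on register 0: sequencing, pairing, branching, folding. -/

/-- Started with `v` in register `0`, the program `p` puts `v'` into register `0` within `T`
steps; register `1` (a stack) is restored, and otherwise only the registers `2, …, 6` may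
change. -/
def Transforms (p : Prog) (v v' : Data) (T : ℕ) : Prop :=
  ∀ s : Store, s 0 = v → ∃ t ≤ T, ∃ s' : Store, Exec p s s' t ∧ s' 0 = v' ∧ s' 1 = s 1 ∧
    ∀ r, 7 ≤ r → s' r = s r

theorem Transforms.mono {p : Prog} {v v' : Data} {T T' : ℕ} (h : Transforms p v v' T)
    (hT : T ≤ T') : Transforms p v v' T' := by
  intro s hs
  obtain ⟨t, ht, h⟩ := h s hs
  exact ⟨t, ht.trans hT, h⟩

theorem Transforms.seq {p q : Prog} {v v' v'' : Data} {T T' : ℕ} (h : Transforms p v v' T)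
    (h' : Transforms q v' v'' T') : Transforms (.seq p q) v v'' (1 + (T + T')) := by
  intro s hs
  obtain ⟨t, ht, s₁, e₁, h0, h1, h2⟩ := h s hs
  obtain ⟨t', ht', s₂, e₂, h0', h1', h2'⟩ := h' s₁ h0
  exact ⟨_, by omega, s₂, e₁.seq e₂, h0', h1'.trans h1, fun r hr => (h2' r hr).trans (h2 r hr)⟩

theorem transforms_id (v : Data) : Transforms (.copy 0 0) v v 1 := by
  intro s hs
  exact ⟨1, le_rfl, _, Exec.copy 0 0 s, by simp [hs], by simp, fun r hr => by
    rw [Function.update_of_ne (by omega)]⟩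

theorem transforms_hd (v : Data) : Transforms (.hd 0 0) v v.hd 1 := by
  intro s hs
  exact ⟨1, le_rfl, _, Exec.hd 0 0 s, by simp [hs], by simp, fun r hr => by
    rw [Function.update_of_ne (by omega)]⟩

theorem transforms_tl (v : Data) : Transforms (.tl 0 0) v v.tl 1 := by
  intro s hs
  exact ⟨1, le_rfl, _, Exec.tl 0 0 s, by simp [hs], by simp, fun r hr => by
    rw [Function.update_of_ne (by omega)]⟩

theorem transforms_nil (v : Data) : Transforms (.setNil 0) v .nil 1 := by
  intro s hs
  exact ⟨1, le_rfl, _, Exec.setNil 0 s, by simp, by simp, fun r hr => by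
    rw [Function.update_of_ne (by omega)]⟩

/-- Run `p` and `q` on the same value and form the pair of the results. -/
def pairProg (p q : Prog) : Prog :=
  .seq (.cons 1 0 1) <| .seq p <| .seq (.hd 2 1) <| .seq (.tl 1 1) <| .seq (.cons 1 0 1) <|
    .seq (.copy 0 2) <| .seq q <| .seq (.hd 2 1) <| .seq (.tl 1 1) (.cons 0 2 0)

/-- Register 1 serves as a stack: it holds the input while `p` runs and the result of `p` while `q`
runs. The constant 17 counts 9 sequencing steps and 8 elementary ones. -/
theorem Transforms.pair {p q : Prog} {v v₁ v₂ : Data} {T₁ T₂ : ℕ} (hp : Transforms p v v₁ T₁)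
    (hq : Transforms q v v₂ T₂) :
    Transforms (pairProg p q) v (.cons v₁ v₂) (17 + (T₁ + T₂)) := by
  intro s hs
  obtain ⟨t₁, ht₁, s₁, e₁, h0, h1, h2⟩ := hp (Function.update s 1 (.cons (s 0) (s 1))) (by simpa)
  set s₁' := Function.update (Function.update (Function.update (Function.update s₁ 2 (s₁ 1).hd)
    1 (s₁ 1).tl) 1 (.cons (s₁ 0) (s₁ 1).tl)) 0 (s₁ 1).hd with hs₁'
  obtain ⟨t₂, ht₂, s₂, e₂, k0, k1, k2⟩ := hq s₁' (by simp [hs₁', h1, hs, Data.hd])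
  refine ⟨_, ?_, _, Exec.seq (Exec.cons 1 0 1 s) <| e₁.seq <| Exec.seq (Exec.hd 2 1 _) <|
    Exec.seq (Exec.tl 1 1 _) <| Exec.seq (Exec.cons 1 0 1 _) <| Exec.seq (Exec.copy 0 2 _) <|
    Exec.seq (s₁ := s₂) (t₁ := t₂) ?_ <| Exec.seq (Exec.hd 2 1 _) <| Exec.seq (Exec.tl 1 1 _) <|
    Exec.cons 0 2 0 _, ?_, ?_, ?_⟩
  · omega
  · convert e₂ using 1
    simp [hs₁']
  · simp [k0, k1, hs₁', h0, Data.hd]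
  · simp [k1, hs₁', h1, Data.tl]
  · intro r hr
    have hn : r ≠ 0 ∧ r ≠ 1 ∧ r ≠ 2 := by omega
    simp [hn, k2 r hr, hs₁', h2 r hr]

/-- Run `c` on the value, and then `p` or `q` on the same value, according to the result. -/
def condProg (c p q : Prog) : Prog :=
  .seq (.cons 1 0 1) <| .seq c <| .seq (.copy 2 0) <| .seq (.hd 0 1) <| .seq (.tl 1 1) <|
    .ite 2 p q

theorem Transforms.cond {c p q : Prog} {v vc v' : Data} {T₁ T₂ : ℕ} (hc : Transforms c v vc T₁)
    (hpq : Transforms (if vc.truth then p else q) v v' T₂) :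
    Transforms (condProg c p q) v v' (10 + (T₁ + T₂)) := by
  intro s hs
  obtain ⟨t₁, ht₁, s₁, e₁, h0, h1, h2⟩ := hc (Function.update s 1 (.cons (s 0) (s 1))) (by simpa)
  set s₁' := Function.update (Function.update (Function.update s₁ 2 (s₁ 0)) 0 (s₁ 1).hd) 1
    (s₁ 1).tl with hs₁'
  obtain ⟨t₂, ht₂, s₂, e₂, k0, k1, k2⟩ := hpq s₁' (by simp [hs₁', h1, hs, Data.hd])
  refine ⟨_, ?_, _, Exec.seq (Exec.cons 1 0 1 s) <| e₁.seq <| Exec.seq (Exec.copy 2 0 _) <|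
    Exec.seq (Exec.hd 0 1 _) <| Exec.seq (Exec.tl 1 1 _) <|
    Exec.ite (s' := s₂) (t := t₂) ?_, k0, ?_, ?_⟩
  · omega
  · convert e₂ using 1
    · simp [h0]
    · simp [hs₁']
  · simp [k1, hs₁', h1, Data.tl]
  · intro r hr
    have hn : r ≠ 0 ∧ r ≠ 1 ∧ r ≠ 2 := by omega
    simp [hn, k2 r hr, hs₁', h2 r hr]

/-- The body of `foldProg`. -/
def foldBody (p : Prog) : Prog :=
  .seq (.hd 3 0) <| .seq (.tl 4 0) <| .seq (.tl 5 3) <| .seq (.hd 3 3) <| .seq (.hd 6 4) <|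
    .seq (.tl 4 4) <| .seq (.cons 5 5 4) <| .seq (.cons 1 5 1) <| .seq (.cons 3 6 3) <|
    .seq (.cons 0 4 3) <| .seq p <|
    .seq (.hd 5 1) <| .seq (.tl 1 1) <| .seq (.hd 3 5) <| .seq (.tl 4 5) <| .seq (.cons 4 0 4) <|
    .seq (.cons 0 3 4) (.copy 2 3)

/-- On `(l, (a, x))`, fold the program `p` over the list `l`, starting with `a`, in the
context `x`. -/
def foldProg (p : Prog) : Prog :=
  .seq (.hd 2 0) <| .seq (.loop 2 (foldBody p)) <| .seq (.tl 0 0) (.hd 0 0)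

theorem Exec.hd_of {x y : ℕ} {s : Store} (v : Data) {w : Data} (h : s y = .cons v w) :
    Exec (.hd x y) s (Function.update s x v) 1 := by
  simpa [h, Data.hd] using Exec.hd x y s

theorem Exec.tl_of {x y : ℕ} {s : Store} {v : Data} (w : Data) (h : s y = .cons v w) :
    Exec (.tl x y) s (Function.update s x w) 1 := by
  simpa [h, Data.tl] using Exec.tl x y s

theorem Exec.cons_of {x y z : ℕ} {s : Store} (v w : Data) (hv : s y = v) (hw : s z = w) :
    Exec (.cons x y z) s (Function.update s x (.cons v w)) 1 := by
  simpa [hv, hw] using Exec.cons x y z s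

theorem Exec.copy_of {x y : ℕ} {s : Store} (v : Data) (h : s y = v) :
    Exec (.copy x y) s (Function.update s x v) 1 := by
  simpa [h] using Exec.copy x y s

/-- While `p` runs only the stack is safe, so the remaining list and the context are pushed there as
one pair. Register 2 ends with the remaining list because it is the loop test. -/
theorem exec_foldBody {p : Prog} {x a a' b l : Data} {T : ℕ}
    (hp : Transforms p (.cons x (.cons a b)) a' T) (s : Store)
    (hs : s 0 = .cons (.cons b l) (.cons a x)) :
    ∃ t ≤ 34 + T, ∃ s', Exec (foldBody p) s s' t ∧ s' 0 = .cons l (.cons a' x) ∧ s' 1 = s 1 ∧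
      s' 2 = l ∧ ∀ r, 7 ≤ r → s' r = s r := by
  obtain ⟨t, ht, s₁, e, h0, h1, h2⟩ := hp (Function.update (Function.update (Function.update
    (Function.update (Function.update (Function.update (Function.update (Function.update
    (Function.update (Function.update s
    3 (.cons b l)) 4 (.cons a x)) 5 l) 3 b) 6 a) 4 x) 5 (.cons l x)) 1 (.cons (.cons l x) (s 1)))
    3 (.cons a b)) 0 (.cons x (.cons a b))) (by simp)
  have h1' : s₁ 1 = .cons (.cons l x) (s 1) := by rw [h1]; simp
  refine ⟨_, ?_, _, Exec.seq (Exec.hd_of (.cons b l) hs) <|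
    Exec.seq (Exec.tl_of (.cons a x) (by simpa using hs)) <|
    Exec.seq (Exec.tl_of (v := b) l (by simp)) <| Exec.seq (Exec.hd_of (w := l) b (by simp)) <|
    Exec.seq (Exec.hd_of (w := x) a (by simp)) <| Exec.seq (Exec.tl_of (v := a) x (by simp)) <|
    Exec.seq (Exec.cons_of l x (by simp) (by simp)) <|
    Exec.seq (Exec.cons_of (.cons l x) (s 1) (by simp) (by simp)) <|
    Exec.seq (Exec.cons_of a b (by simp) (by simp)) <|
    Exec.seq (Exec.cons_of x (.cons a b) (by simp) (by simp)) <| e.seq <|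
    Exec.seq (Exec.hd_of (.cons l x) h1') <|
    Exec.seq (Exec.tl_of (v := .cons l x) (s 1) (by simp [h1'])) <|
    Exec.seq (Exec.hd_of (w := x) l (by simp)) <| Exec.seq (Exec.tl_of (v := l) x (by simp)) <|
    Exec.seq (Exec.cons_of a' x (by simp [h0]) (by simp)) <|
    Exec.seq (Exec.cons_of l (.cons a' x) (by simp) (by simp)) <|
    Exec.copy_of l (by simp), ?_, ?_, ?_, ?_⟩
  · clear e h0 h1 h2 h1' hp hs
    linarith
  · simp
  · simp
  · simp
  · intro r hr
    have hn : r ≠ 0 ∧ r ≠ 1 ∧ r ≠ 2 ∧ r ≠ 3 ∧ r ≠ 4 ∧ r ≠ 5 ∧ r ≠ 6 := by omega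
    simp [hn, h2 r hr]

/-- A list of data as data. -/
def Data.ofList : List Data → Data
  | [] => .nil
  | a :: l => .cons a (Data.ofList l)

/-- The hypothesis on `p` is restricted to accumulators that actually arise from prefixes of the
list, since a uniform time bound is available only for those. -/
theorem exec_foldLoop {β γ : Type} {p : Prog} {x : Data} {eb : β → Data} {ec : γ → Data}
    {h : γ → β → γ} {T : ℕ} (l : List β) (a : γ) (hp : ∀ l₁ b l₂, l = l₁ ++ b :: l₂ →
      Transforms p (.cons x (.cons (ec (l₁.foldl h a)) (eb b))) (ec (h (l₁.foldl h a) b)) T)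
    (s : Store) (hs : s 0 = .cons (.ofList (l.map eb)) (.cons (ec a) x))
    (hs2 : s 2 = .ofList (l.map eb)) :
    ∃ t ≤ 1 + l.length * (35 + T), ∃ s', Exec (.loop 2 (foldBody p)) s s' t ∧
      s' 0 = .cons .nil (.cons (ec (l.foldl h a)) x) ∧ s' 1 = s 1 ∧ ∀ r, 7 ≤ r → s' r = s r := by
  induction l generalizing a s with
  | nil => exact ⟨1, by simp, s, Exec.loop_false (by simp [hs2, Data.ofList, Data.truth]), by
      simp [hs, Data.ofList], rfl, fun _ _ => rfl⟩
  | cons b l ih =>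
    obtain ⟨t₁, ht₁, s₁, e₁, h0, h1, h2, h3⟩ := exec_foldBody (hp [] b l rfl) s hs
    obtain ⟨t₂, ht₂, s₂, e₂, k0, k1, k2⟩ := ih (h a b)
      (fun l₁ b' l₂ hl => hp (b :: l₁) b' l₂ (by simp [hl])) s₁ h0 h2
    refine ⟨_, ?_, s₂, Exec.loop_true (by simp [hs2, Data.ofList, Data.truth]) e₁ e₂, k0,
      k1.trans h1, fun r hr => (k2 r hr).trans (h3 r hr)⟩
    rw [List.length_cons, Nat.succ_mul]
    omega

theorem transforms_foldProg {β γ : Type} {p : Prog} {x : Data} {eb : β → Data} {ec : γ → Data}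
    {h : γ → β → γ} {T : ℕ} (l : List β) (a : γ) (hp : ∀ l₁ b l₂, l = l₁ ++ b :: l₂ →
      Transforms p (.cons x (.cons (ec (l₁.foldl h a)) (eb b))) (ec (h (l₁.foldl h a) b)) T) :
    Transforms (foldProg p) (.cons (.ofList (l.map eb)) (.cons (ec a) x)) (ec (l.foldl h a))
      (7 + l.length * (35 + T)) := by
  intro s hs
  obtain ⟨t, ht, s₁, e, h0, h1, h2⟩ := exec_foldLoop l a hp
    (Function.update s 2 (s 0).hd) (by simp [hs]) (by simp [hs, Data.hd])
  refine ⟨_, ?_, _, Exec.seq (Exec.hd 2 0 s) <| e.seq <| Exec.seq (Exec.tl 0 0 _) <|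
    Exec.hd 0 0 _, ?_, ?_, ?_⟩
  · omega
  · simp [h0, Data.tl, Data.hd]
  · simp [h1]
  · intro r hr
    have hn : r ≠ 0 ∧ r ≠ 1 ∧ r ≠ 2 := by omega
    simp [hn, h2 r hr]

/-! ## Encodings of types as data -/

/-- The number of nodes of the tree unfolding. -/
def Data.size : Data → ℕ
  | .nil => 1
  | .cons a b => a.size + b.size + 1

theorem Data.size_pos (d : Data) : 0 < d.size := by
  cases d <;> simp [Data.size]

/-- Types whose elements are represented as data. -/
class Enc (α : Type) where
  enc : α → Data

open Enc

instance : Enc Bool := ⟨Data.ofBit⟩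
instance {α β : Type} [Enc α] [Enc β] : Enc (α × β) := ⟨fun p => .cons (enc p.1) (enc p.2)⟩
instance {α : Type} [Enc α] : Enc (List α) := ⟨fun l => .ofList (l.map enc)⟩
instance : Enc ℕ := ⟨fun n => enc (List.replicate n true)⟩

/-! ## Polynomial time -/

/-- The size of the encoding of `x`. -/
def sz {α : Type} [Enc α] (x : α) : ℕ := (enc x).size

section
variable {α β γ δ : Type} [Enc α] [Enc β] [Enc γ] [Enc δ]

/-- `f` is computed by a program in time polynomial in `μ`. -/
def PolyTimeIn (μ : α → ℕ) (f : α → β) : Prop :=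
  ∃ (p : Prog) (P : Polynomial ℕ), ∀ x, sz (f x) ≤ P.eval (μ x) ∧
    Transforms p (enc x) (enc (f x)) (P.eval (μ x))

/-- `f` is computed by a program in polynomial time. -/
@[fun_prop]
def PolyTime (f : α → β) : Prop := PolyTimeIn sz f

theorem eval_mono (P : Polynomial ℕ) {m n : ℕ} (h : m ≤ n) : P.eval m ≤ P.eval n := by
  simp only [Polynomial.eval_eq_sum, Polynomial.sum]
  exact Finset.sum_le_sum fun i _ => by gcongr

/-- The bound on the output size that is built into `PolyTimeIn` is what makes this work: the
running time of `g` is polynomial in the size of `f x`. The free measure μ allows outputs of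
exponential size, such as the alphabet. -/
theorem PolyTimeIn.comp {μ : α → ℕ} {f : α → β} {g : β → γ} (hg : PolyTime g)
    (hf : PolyTimeIn μ f) : PolyTimeIn μ (fun x => g (f x)) := by
  obtain ⟨p, P, hp⟩ := hf
  obtain ⟨q, Q, hq⟩ := hg
  refine ⟨.seq p q, 1 + (P + Q.comp P), fun x => ?_⟩
  obtain ⟨h1, h2⟩ := hp x
  obtain ⟨h3, h4⟩ := hq (f x)
  have h5 := eval_mono Q h1
  simp only [Polynomial.eval_add, Polynomial.eval_comp, Polynomial.eval_one]
  exact ⟨by omega, (h2.seq h4).mono (by omega)⟩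

theorem PolyTimeIn.prodMk {μ : α → ℕ} {f : α → β} {g : α → γ} (hf : PolyTimeIn μ f)
    (hg : PolyTimeIn μ g) : PolyTimeIn μ (fun x => (f x, g x)) := by
  obtain ⟨p, P, hp⟩ := hf
  obtain ⟨q, Q, hq⟩ := hg
  refine ⟨pairProg p q, 17 + (P + Q), fun x => ?_⟩
  obtain ⟨h1, h2⟩ := hp x
  obtain ⟨h3, h4⟩ := hq x
  simp only [Polynomial.eval_add, Polynomial.eval_ofNat]
  refine ⟨?_, h2.pair h4⟩
  change (enc (f x)).size + (enc (g x)).size + 1 ≤ _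
  unfold sz at h1 h3
  omega

theorem PolyTimeIn.id {μ : α → ℕ} (hμ : ∀ x, sz x ≤ μ x) : PolyTimeIn μ (fun x : α => x) :=
  ⟨_, .X + 1, fun x => ⟨by simpa using (hμ x).trans (Nat.le_succ _),
    (transforms_id (enc x)).mono (by simp)⟩⟩

theorem PolyTime.toPolyTimeIn {μ : α → ℕ} (hμ : ∀ x, sz x ≤ μ x) {f : α → β}
    (hf : PolyTime f) : PolyTimeIn μ f :=
  PolyTimeIn.comp hf (.id hμ)

@[fun_prop]
theorem PolyTime.id : PolyTime (fun x : α => x) := PolyTimeIn.id fun _ => le_rfl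

@[fun_prop]
theorem PolyTime.comp {f : α → β} {g : β → γ} (hg : PolyTime g) (hf : PolyTime f) :
    PolyTime (fun x => g (f x)) := PolyTimeIn.comp hg hf

@[fun_prop]
theorem PolyTime.prodMk {f : α → β} {g : α → γ} (hf : PolyTime f) (hg : PolyTime g) :
    PolyTime (fun x => (f x, g x)) := PolyTimeIn.prodMk hf hg

/-- A program with constant result. -/
def constProg : Data → Prog
  | .nil => .setNil 0
  | .cons a b => pairProg (constProg a) (constProg b)

theorem transforms_constProg (d v : Data) : Transforms (constProg d) v d (17 * d.size) := by
  induction d with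
  | nil => exact (transforms_nil v).mono (by simp [Data.size])
  | cons a b iha ihb => exact (iha.pair ihb).mono (by simp only [Data.size]; omega)

@[fun_prop]
theorem PolyTime.const (b : β) : PolyTime (fun _ : α => b) :=
  ⟨_, .C (17 * sz b), fun x => by
    rw [Polynomial.eval_C]
    exact ⟨Nat.le_mul_of_pos_left _ (by norm_num), transforms_constProg _ _⟩⟩

theorem polyTime_fst : PolyTime (fun p : α × β => p.1) :=
  ⟨_, .X + 1, fun x => by
    simp only [Polynomial.eval_add, Polynomial.eval_X, Polynomial.eval_one]
    refine ⟨?_, (transforms_hd _).mono (by omega)⟩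
    change _ ≤ (enc x.1).size + (enc x.2).size + 1 + 1
    unfold sz
    omega⟩

theorem polyTime_snd : PolyTime (fun p : α × β => p.2) :=
  ⟨_, .X + 1, fun x => by
    simp only [Polynomial.eval_add, Polynomial.eval_X, Polynomial.eval_one]
    refine ⟨?_, (transforms_tl _).mono (by omega)⟩
    change _ ≤ (enc x.1).size + (enc x.2).size + 1 + 1
    unfold sz
    omega⟩

@[fun_prop]
theorem PolyTime.fst {f : α → β × γ} (hf : PolyTime f) : PolyTime (fun x => (f x).1) :=
  polyTime_fst.comp hf

@[fun_prop]
theorem PolyTime.snd {f : α → β × γ} (hf : PolyTime f) : PolyTime (fun x => (f x).2) :=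
  polyTime_snd.comp hf

/-- Branching on whether the code of `c x` is a cell. -/
theorem PolyTime.ite_truth {c : α → δ} {f g : α → β} (hc : PolyTime c) (hf : PolyTime f)
    (hg : PolyTime g) : PolyTime (fun x => if (enc (c x)).truth then f x else g x) := by
  obtain ⟨p, P, hp⟩ := hf
  obtain ⟨q, Q, hq⟩ := hg
  obtain ⟨r, R, hr⟩ := hc
  refine ⟨condProg r p q, 10 + (R + (P + Q)), fun x => ?_⟩
  obtain ⟨h1, h2⟩ := hp x
  obtain ⟨h3, h4⟩ := hq x
  obtain ⟨h5, h6⟩ := hr x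
  simp only [Polynomial.eval_add, Polynomial.eval_ofNat]
  constructor
  · split <;> omega
  · refine h6.cond ?_
    split
    · exact h2.mono (by omega)
    · exact h4.mono (by omega)

@[fun_prop]
theorem PolyTime.ite {c : α → Bool} {f g : α → β} (hc : PolyTime c) (hf : PolyTime f)
    (hg : PolyTime g) : PolyTime (fun x => if c x = true then f x else g x) := by
  convert PolyTime.ite_truth hc hf hg using 4 with x
  cases c x <;> simp [enc, Data.ofBit, Data.truth]

@[fun_prop]
theorem PolyTime.isEmpty {f : α → List β} (hf : PolyTime f) :
    PolyTime (fun x => (f x).isEmpty) := by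
  convert PolyTime.ite_truth hf (PolyTime.const false) (PolyTime.const true) using 2 with x
  cases f x <;> simp [enc, Data.ofList, Data.truth]

@[fun_prop]
theorem PolyTime.not {f : α → Bool} (hf : PolyTime f) : PolyTime (fun x => !(f x)) := by
  convert PolyTime.ite hf (PolyTime.const false) (PolyTime.const true) using 2 with x
  cases f x <;> rfl

@[fun_prop]
theorem PolyTime.and {f g : α → Bool} (hf : PolyTime f) (hg : PolyTime g) :
    PolyTime (fun x => f x && g x) := by
  convert PolyTime.ite hf hg (PolyTime.const false) using 2 with x
  cases f x <;> rfl

@[fun_prop]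
theorem PolyTime.or {f g : α → Bool} (hf : PolyTime f) (hg : PolyTime g) :
    PolyTime (fun x => f x || g x) := by
  convert PolyTime.ite hf (PolyTime.const true) hg using 2 with x
  cases f x <;> rfl

@[fun_prop]
theorem PolyTime.beqBool {f g : α → Bool} (hf : PolyTime f) (hg : PolyTime g) :
    PolyTime (fun x => f x == g x) := by
  convert PolyTime.ite hf hg (hg.not) using 2 with x
  cases f x <;> cases g x <;> rfl

/-! ### Lists -/

theorem sz_nil : sz ([] : List α) = 1 := rfl

theorem sz_cons (a : α) (l : List α) : sz (a :: l) = sz a + sz l + 1 := rfl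

theorem sz_pos (x : α) : 0 < sz x := Data.size_pos _

theorem sz_prod (p : α × β) : sz p = sz p.1 + sz p.2 + 1 := rfl

theorem sz_append (l l' : List α) : sz (l ++ l') + 1 = sz l + sz l' := by
  induction l with
  | nil => simp [sz_nil]; omega
  | cons a l ih => simp only [List.cons_append, sz_cons]; omega

theorem sz_le_of_mem {a : α} {l : List α} (h : a ∈ l) : sz a ≤ sz l := by
  induction l with
  | nil => simp at h
  | cons b l ih =>
    rw [sz_cons]
    rcases List.mem_cons.1 h with rfl | h
    · omega
    · have := ih h; omega

theorem length_le_sz (l : List α) : l.length ≤ sz l := by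
  induction l with
  | nil => simp
  | cons b l ih => rw [sz_cons, List.length_cons]; omega

theorem sz_le_length_mul (l : List α) {B : ℕ} (h : ∀ a ∈ l, sz a ≤ B) :
    sz l ≤ l.length * (B + 1) + 1 := by
  induction l with
  | nil => simp [sz_nil]
  | cons b l ih =>
    have h1 := h b (by simp)
    have h2 := ih fun a ha => h a (by simp [ha])
    rw [sz_cons, List.length_cons, Nat.succ_mul]
    omega

theorem sz_eq_length (l : List Bool) (h : ∀ a ∈ l, a = true) : sz l = 4 * l.length + 1 := by
  induction l with
  | nil => simp [sz_nil]
  | cons b l ih =>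
    have h1 := h b (by simp)
    have h2 := ih fun a ha => h a (by simp [ha])
    subst h1
    rw [sz_cons, List.length_cons, h2]
    simp [sz, enc, Data.ofBit, Data.size]
    omega

theorem sz_nat (n : ℕ) : sz n = 4 * n + 1 := by
  have := sz_eq_length (List.replicate n true) (by simp)
  rwa [List.length_replicate] at this

/-- Iterating a polynomial-time step may produce exponentially large values, hence the separate
bound `Q` on every intermediate accumulator. With it, each step has an input of polynomial size. -/
theorem PolyTimeIn.foldl {μ : α → ℕ} (hμ : ∀ x, sz x ≤ μ x) {f : α → List β} {g : α → γ}
    {h : α → γ → β → γ} (hf : PolyTimeIn μ f) (hg : PolyTimeIn μ g)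
    (hh : PolyTime (fun p : α × (γ × β) => h p.1 p.2.1 p.2.2)) (Q : Polynomial ℕ)
    (hQ : ∀ x l, l <+: f x → sz (l.foldl (h x) (g x)) ≤ Q.eval (μ x)) :
    PolyTimeIn μ (fun x => (f x).foldl (h x) (g x)) := by
  obtain ⟨p, P, hp⟩ := hf
  obtain ⟨q, R, hq⟩ := hg
  obtain ⟨r, S, hr⟩ := hh
  refine ⟨.seq (pairProg p (pairProg q (.copy 0 0))) (foldProg r),
    50 + (P + R) + Q + P * (35 + S.comp (.X + Q + P + 2)), fun x => ?_⟩
  obtain ⟨h1, h2⟩ := hp x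
  obtain ⟨h3, h4⟩ := hq x
  have hfold : Transforms (foldProg r) (.cons (enc (f x)) (.cons (enc (g x)) (enc x)))
      (enc ((f x).foldl (h x) (g x))) _ :=
    transforms_foldProg (p := r) (x := enc x) (eb := enc) (ec := enc) (h := h x)
      (T := S.eval (μ x + Q.eval (μ x) + P.eval (μ x) + 2)) (f x) (g x)
      (fun l₁ b l₂ hl => by
        refine (hr (x, l₁.foldl (h x) (g x), b)).2.mono (eval_mono _ ?_)
        have a1 := hQ x l₁ (by rw [hl]; exact List.prefix_append _ _)
        have a2 : sz b ≤ sz (f x) := sz_le_of_mem (by simp [hl])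
        have a3 := hμ x
        simp only [sz_prod]
        omega)
  have hlen := (length_le_sz (f x)).trans h1
  have hmul := Nat.mul_le_mul_right (35 + S.eval (μ x + Q.eval (μ x) + P.eval (μ x) + 2)) hlen
  have hfin := hQ x (f x) List.prefix_rfl
  simp only [Polynomial.eval_add, Polynomial.eval_mul, Polynomial.eval_comp, Polynomial.eval_X,
    Polynomial.eval_ofNat]
  refine ⟨by omega, ((h2.pair (h4.pair (transforms_id _))).seq hfold).mono (by omega)⟩

theorem PolyTime.foldl {f : α → List β} {g : α → γ} {h : α → γ → β → γ} (hf : PolyTime f)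
    (hg : PolyTime g) (hh : PolyTime (fun p : α × (γ × β) => h p.1 p.2.1 p.2.2))
    (Q : Polynomial ℕ) (hQ : ∀ x l, l <+: f x → sz (l.foldl (h x) (g x)) ≤ Q.eval (sz x)) :
    PolyTime (fun x => (f x).foldl (h x) (g x)) :=
  PolyTimeIn.foldl (fun _ => le_rfl) hf hg hh Q hQ

theorem PolyTime.exists_sz_le {f : α → β} (hf : PolyTime f) :
    ∃ P : Polynomial ℕ, ∀ x, sz (f x) ≤ P.eval (sz x) := by
  obtain ⟨_, P, hP⟩ := hf
  exact ⟨P, fun x => (hP x).1⟩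

theorem sz_le_of_prefix {l l' : List α} (h : l <+: l') : sz l ≤ sz l' := by
  obtain ⟨r, rfl⟩ := h
  have := sz_append l r
  have := sz_pos r
  omega

@[fun_prop]
theorem PolyTime.cons {f : α → β} {g : α → List β} (hf : PolyTime f) (hg : PolyTime g) :
    PolyTime (fun x => f x :: g x) := hf.prodMk hg

@[fun_prop]
theorem PolyTime.tail {f : α → List β} (hf : PolyTime f) : PolyTime (fun x => (f x).tail) := by
  refine PolyTime.comp (g := List.tail) ⟨.tl 0 0, .X + 1, fun l => ?_⟩ hf
  simp only [Polynomial.eval_add, Polynomial.eval_X, Polynomial.eval_one]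
  have h : enc l.tail = (enc l).tl := by cases l <;> rfl
  refine ⟨?_, h ▸ (transforms_tl _).mono (by omega)⟩
  cases l with
  | nil => simp [sz_nil]
  | cons a l => rw [sz_cons, List.tail_cons]; omega

-- The default `false` is forced: the machine's head of `nil` is `nil`, which is the code of
-- `false`.
@[fun_prop]
theorem PolyTime.headD_false {f : α → List Bool} (hf : PolyTime f) :
    PolyTime (fun x => (f x).headD false) := by
  refine PolyTime.comp (g := fun l => l.headD false) ⟨.hd 0 0, .X + 1, fun l => ?_⟩ hf
  simp only [Polynomial.eval_add, Polynomial.eval_X, Polynomial.eval_one]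
  have h : enc (l.headD false) = (enc l).hd := by cases l <;> rfl
  refine ⟨?_, h ▸ (transforms_hd _).mono (by omega)⟩
  cases l with
  | nil => simp [sz, enc, Data.ofBit, Data.size]
  | cons a l => rw [sz_cons, List.headD_cons]; omega

theorem foldl_flip_cons {σ : Type} (l a : List σ) : l.foldl (fun a b => b :: a) a = l.reverse ++ a := by
  induction l generalizing a with
  | nil => rfl
  | cons b l ih => simp [ih]

theorem sz_reverse (l : List α) : sz l.reverse = sz l := by
  induction l with
  | nil => rfl
  | cons a l ih =>
    have := sz_append l.reverse [a]
    rw [List.reverse_cons, sz_cons]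
    rw [sz_cons, sz_nil] at this
    omega

/-- Folding with cons reverses one list onto another; this yields reversal and, after a second
reversal, concatenation. -/
theorem PolyTime.reverseAux {f g : α → List β} (hf : PolyTime f) (hg : PolyTime g) :
    PolyTime (fun x => (f x).reverse ++ g x) := by
  obtain ⟨P, hP⟩ := hf.exists_sz_le
  obtain ⟨Q, hQ⟩ := hg.exists_sz_le
  have := PolyTime.foldl (h := fun _ a b => b :: a) hf hg (by fun_prop) (P + Q) (fun x l hl => by
    have h1 := hP x
    have h2 := hQ x
    have h3 := sz_le_of_prefix hl
    have h4 := sz_append l.reverse (g x)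
    have h5 := sz_reverse l
    rw [foldl_flip_cons, Polynomial.eval_add]
    omega)
  simpa only [foldl_flip_cons] using this

@[fun_prop]
theorem PolyTime.reverse {f : α → List β} (hf : PolyTime f) :
    PolyTime (fun x => (f x).reverse) := by
  simpa using hf.reverseAux (PolyTime.const [])

@[fun_prop]
theorem PolyTime.append {f g : α → List β} (hf : PolyTime f) (hg : PolyTime g) :
    PolyTime (fun x => f x ++ g x) := by
  simpa using hf.reverse.reverseAux hg

theorem foldl_append_flatMap {σ τ : Type} (l : List σ) (f : σ → List τ) (a : List τ) :
    l.foldl (fun a b => a ++ f b) a = a ++ l.flatMap f := by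
  induction l generalizing a with
  | nil => simp
  | cons b l ih => simp [ih]

theorem sz_flatMap_le {σ : Type} (l : List σ) (f : σ → List β) (B : ℕ) (h : ∀ a ∈ l, sz (f a) ≤ B) :
    sz (l.flatMap f) ≤ l.length * B + 1 := by
  induction l with
  | nil => simp [sz_nil]
  | cons b l ih =>
    have h1 := h b (by simp)
    have h2 := ih fun a ha => h a (by simp [ha])
    have h3 := sz_append (f b) (l.flatMap f)
    rw [List.flatMap_cons, List.length_cons, Nat.succ_mul]
    omega

@[fun_prop]
theorem PolyTime.flatMap {f : α → List β} {g : α → β → List γ} (hf : PolyTime f)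
    (hg : PolyTime (fun p : α × β => g p.1 p.2)) :
    PolyTime (fun x => (f x).flatMap (g x)) := by
  obtain ⟨P, hP⟩ := hf.exists_sz_le
  obtain ⟨Q, hQ⟩ := hg.exists_sz_le
  have := PolyTime.foldl (h := fun x a b => a ++ g x b) hf (PolyTime.const [])
    (PolyTime.append (by fun_prop) (hg.comp (f := fun p : α × (List γ × β) => (p.1, p.2.2))
      (by fun_prop))) (P * Q.comp (.X + P + 1) + 1) (fun x l hl => by
    rw [foldl_append_flatMap, List.nil_append]
    refine (sz_flatMap_le l _ (Q.eval (sz x + P.eval (sz x) + 1)) ?_).trans ?_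
    · intro b hb
      refine (hQ (x, b)).trans (eval_mono _ ?_)
      have h1 := sz_le_of_mem (hl.subset hb)
      have h2 := hP x
      rw [sz_prod]
      dsimp only
      omega
    · have h1 := hP x
      have h2 := length_le_sz (f x)
      have h3 := hl.length_le
      simp only [Polynomial.eval_add, Polynomial.eval_mul, Polynomial.eval_comp,
        Polynomial.eval_X, Polynomial.eval_one]
      gcongr
      omega)
  simpa only [foldl_append_flatMap, List.nil_append] using this

@[fun_prop]
theorem PolyTime.map {f : α → List β} {g : α → β → γ} (hf : PolyTime f)
    (hg : PolyTime (fun p : α × β => g p.1 p.2)) : PolyTime (fun x => (f x).map (g x)) := by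
  simp only [List.map_eq_flatMap]
  fun_prop

@[fun_prop]
theorem PolyTime.filter {f : α → List β} {g : α → β → Bool} (hf : PolyTime f)
    (hg : PolyTime (fun p : α × β => g p.1 p.2)) : PolyTime (fun x => (f x).filter (g x)) := by
  have h (x : α) : (f x).filter (g x) = (f x).flatMap fun b => if g x b = true then [b] else [] := by
    induction f x with
    | nil => rfl
    | cons b l ih => rw [List.filter_cons, List.flatMap_cons, ih]; split <;> rfl
  simp only [h]
  fun_prop

@[fun_prop]
theorem PolyTime.any {f : α → List β} {g : α → β → Bool} (hf : PolyTime f)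
    (hg : PolyTime (fun p : α × β => g p.1 p.2)) : PolyTime (fun x => (f x).any (g x)) := by
  have h (x : α) : (f x).any (g x) = !((f x).filter (g x)).isEmpty := by
    rw [Bool.eq_iff_iff]
    simp
  simp only [h]
  fun_prop

@[fun_prop]
theorem PolyTime.all {f : α → List β} {g : α → β → Bool} (hf : PolyTime f)
    (hg : PolyTime (fun p : α × β => g p.1 p.2)) : PolyTime (fun x => (f x).all (g x)) := by
  have h (x : α) : (f x).all (g x) = !(f x).any (fun b => !g x b) := by
    rw [Bool.eq_iff_iff]
    simp
  simp only [h]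
  fun_prop

/-! ### Natural numbers -/

-- Numbers are coded in unary, so a number and the list of that many `true` have the same code.
-- Arithmetic thereby reduces to list operations.
@[fun_prop]
theorem PolyTime.replicate_true {f : α → ℕ} (hf : PolyTime f) :
    PolyTime (fun x => List.replicate (f x) true) := hf

theorem PolyTime.of_replicate_true {f : α → ℕ}
    (hf : PolyTime (fun x => List.replicate (f x) true)) : PolyTime f := hf

@[fun_prop]
theorem PolyTime.length {f : α → List β} (hf : PolyTime f) :
    PolyTime (fun x => (f x).length) := by
  apply PolyTime.of_replicate_true
  have h (x : α) : List.replicate (f x).length true = (f x).map fun _ => true := by simp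
  simp only [h]
  fun_prop

@[fun_prop]
theorem PolyTime.add {f g : α → ℕ} (hf : PolyTime f) (hg : PolyTime g) :
    PolyTime (fun x => f x + g x) := by
  have h (x : α) : f x + g x = (List.replicate (f x) true ++ List.replicate (g x) true).length := by
    simp
  simp only [h]
  fun_prop

@[fun_prop]
theorem PolyTime.mul {f g : α → ℕ} (hf : PolyTime f) (hg : PolyTime g) :
    PolyTime (fun x => f x * g x) := by
  have h (x : α) : f x * g x =
      ((List.replicate (f x) true).flatMap fun _ => List.replicate (g x) true).length := by
    simp [List.length_flatMap]
  simp only [h]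
  fun_prop

theorem foldl_tail {σ τ : Type} (l : List σ) (a : List τ) : l.foldl (fun a _ => a.tail) a = a.drop l.length := by
  induction l generalizing a with
  | nil => simp
  | cons b l ih => simp [ih]

-- Truncated subtraction is repeated removal of the first element.
@[fun_prop]
theorem PolyTime.sub {f g : α → ℕ} (hf : PolyTime f) (hg : PolyTime g) :
    PolyTime (fun x => f x - g x) := by
  apply PolyTime.of_replicate_true
  obtain ⟨P, hP⟩ := hf.exists_sz_le
  have := PolyTime.foldl (h := fun _ (a : List Bool) (_ : Bool) => a.tail) hg.replicate_true
    hf.replicate_true (by fun_prop) P (fun x l _ => by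
      rw [foldl_tail]
      refine le_trans ?_ (hP x)
      have h1 := sz_append ((List.replicate (f x) true).take l.length)
        ((List.replicate (f x) true).drop l.length)
      have h2 := sz_pos ((List.replicate (f x) true).take l.length)
      rw [List.take_append_drop] at h1
      have h3 : sz (List.replicate (f x) true) = sz (f x) := rfl
      omega)
  simpa only [foldl_tail, List.length_replicate, List.drop_replicate] using this

@[fun_prop]
theorem PolyTime.le {f g : α → ℕ} (hf : PolyTime f) (hg : PolyTime g) :
    PolyTime (fun x => decide (f x ≤ g x)) := by
  have h (x : α) : decide (f x ≤ g x) = (List.replicate (f x - g x) true).isEmpty := by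
    rw [Bool.eq_iff_iff]
    simp [Nat.sub_eq_zero_iff_le]
  simp only [h]
  fun_prop

@[fun_prop]
theorem PolyTime.lt {f g : α → ℕ} (hf : PolyTime f) (hg : PolyTime g) :
    PolyTime (fun x => decide (f x < g x)) := by
  simp only [← Nat.succ_le_iff, Nat.succ_eq_add_one]
  fun_prop

@[fun_prop]
theorem PolyTime.beqNat {f g : α → ℕ} (hf : PolyTime f) (hg : PolyTime g) :
    PolyTime (fun x => f x == g x) := by
  have h (x : α) : (f x == g x) = (decide (f x ≤ g x) && decide (g x ≤ f x)) := by
    rw [Bool.eq_iff_iff, beq_iff_eq, Bool.and_eq_true, decide_eq_true_eq, decide_eq_true_eq]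
    exact le_antisymm_iff
  simp only [h]
  fun_prop

@[fun_prop]
theorem PolyTime.range {f : α → ℕ} (hf : PolyTime f) : PolyTime (fun x => List.range (f x)) := by
  have hr (l : List Bool) :
      l.foldl (fun (a : List ℕ) _ => a ++ [a.length]) [] = List.range l.length := by
    induction l using List.reverseRecOn with
    | nil => rfl
    | append_singleton l b ih => simp [ih, List.range_succ]
  obtain ⟨P, hP⟩ := hf.exists_sz_le
  have := PolyTime.foldl (h := fun _ (a : List ℕ) (_ : Bool) => a ++ [a.length])
    hf.replicate_true (PolyTime.const []) (by fun_prop) (P * (4 * P + 1 + 1) + 1) (fun x l hl => by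
      have h1 := length_le_sz (List.replicate (f x) true)
      have h2 := hl.length_le
      have h3 : sz (List.replicate (f x) true) = sz (f x) := rfl
      have h4 := hP x
      have h5 : l.length ≤ P.eval (sz x) := by omega
      rw [hr]
      refine (sz_le_length_mul _ (B := 4 * P.eval (sz x) + 1) fun a ha => ?_).trans ?_
      · rw [sz_nat]
        have := List.mem_range.1 ha
        omega
      · simp only [Polynomial.eval_add, Polynomial.eval_mul, Polynomial.eval_one,
          Polynomial.eval_ofNat, List.length_range]
        gcongr)
  simpa only [hr, List.length_replicate] using this

-- The quotient counts the i with (i+1)·g ≤ f. Division by zero is treated separately, because there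
-- every i would be counted.
@[fun_prop]
theorem PolyTime.div {f g : α → ℕ} (hf : PolyTime f) (hg : PolyTime g) :
    PolyTime (fun x => f x / g x) := by
  have h (x : α) : f x / g x = if decide (0 < g x) = true then
      ((List.range (f x)).filter fun i => decide ((i + 1) * g x ≤ f x)).length else 0 := by
    split
    · rename_i hpos
      rw [decide_eq_true_eq] at hpos
      have h1 (i : ℕ) : decide ((i + 1) * g x ≤ f x) = decide (i < f x / g x) := by
        rw [decide_eq_decide, ← Nat.le_div_iff_mul_le hpos, Nat.succ_le_iff]
      simp only [h1]
      have h2 : f x / g x ≤ f x := Nat.div_le_self _ _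
      generalize f x / g x = d at h2
      obtain ⟨e, he⟩ := Nat.exists_eq_add_of_le h2
      rw [he, List.range_add, List.filter_append, List.filter_eq_self.2 (by simp),
        List.filter_eq_nil_iff.2 (by simp)]
      simp
    · rename_i hpos
      simp only [decide_eq_true_eq, Nat.pos_iff_ne_zero, not_not] at hpos
      simp [hpos]
  simp only [h]
  fun_prop

@[fun_prop]
theorem PolyTime.mod {f g : α → ℕ} (hf : PolyTime f) (hg : PolyTime g) :
    PolyTime (fun x => f x % g x) := by
  simp only [Nat.mod_eq_sub_mul_div]
  fun_prop

@[fun_prop]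
theorem PolyTime.countP {f : α → List β} {g : α → β → Bool} (hf : PolyTime f)
    (hg : PolyTime (fun p : α × β => g p.1 p.2)) : PolyTime (fun x => (f x).countP (g x)) := by
  simp only [List.countP_eq_length_filter]
  fun_prop

end

/-! ## The reduction -/

/-- A clause over the variables `0, 1, 2, …`. -/
abbrev RawClause : Type := (ℕ × Bool) × (ℕ × Bool) × (ℕ × Bool)

/-- The three literals of a clause. -/
def lits (c : RawClause) : List (ℕ × Bool) := [c.1, c.2.1, c.2.2]

/-- The occurrences of variables in a list of clauses. -/
def occs (L : List RawClause) : List ℕ := L.flatMap fun c => (lits c).map fun l => l.1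

/-- The number of occurrences of variables smaller than `x`. -/
def occsBelow (L : List RawClause) (x : ℕ) : ℕ := (occs L).countP fun y => decide (y < x)

/-- The number of occurrences of variables not larger than `x`. -/
def occsUpTo (L : List RawClause) (x : ℕ) : ℕ := (occs L).countP fun y => decide (y ≤ x)

/-- The number of occurrences in one of `ℓ` groups. -/
def groupWidth (ℓ : ℕ) (L : List RawClause) : ℕ := (occs L).length / ℓ + 1

/-- With the occurrences sorted by variables and cut into `ℓ` groups, the group that contains all
the occurrences of `x`, or `ℓ` if these are spread over several groups. -/
def groupOf (ℓ : ℕ) (L : List RawClause) (x : ℕ) : ℕ :=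
  if decide (occsBelow L x / groupWidth ℓ L < (occsUpTo L x - 1) / groupWidth ℓ L) = true then ℓ
  else occsBelow L x / groupWidth ℓ L

/-- The groups of the variables of a clause. -/
def clauseType (ℓ : ℕ) (L : List RawClause) (c : RawClause) : ℕ × ℕ × ℕ :=
  (groupOf ℓ L c.1.1, groupOf ℓ L c.2.1.1, groupOf ℓ L c.2.2.1)

/-- Equality of types of clauses. -/
def typeEq (τ τ' : ℕ × ℕ × ℕ) : Bool := τ.1 == τ'.1 && (τ.2.1 == τ'.2.1 && τ.2.2 == τ'.2.2)

/-- Number the clauses of `L'` of each type cyclically by `0, …, ℓ - 1`. -/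
def dealOut (ℓ : ℕ) (L L' : List RawClause) : List (RawClause × ℕ) :=
  L'.foldl (fun acc c => acc ++ [(c, acc.countP
    (fun p => typeEq (clauseType ℓ L p.1) (clauseType ℓ L c)) % ℓ)]) []

/-- The clauses with number `i`. -/
def block (ℓ : ℕ) (L : List RawClause) (i : ℕ) : List RawClause :=
  ((dealOut ℓ L L).filter fun p => p.2 == i).map fun p => p.1

/-- The variables of group `t`, and those below `n` that are in no group. -/
def groupVars (ℓ n : ℕ) (L : List RawClause) (t : ℕ) : List ℕ :=
  ((occs L).filter fun x => groupOf ℓ L x == t) ++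
    (List.range n).filter fun x => groupOf ℓ L x == ℓ

/-- The data of a vertex: its side of the bipartite graph, the clauses to be satisfied at it, and
the variables to which the letters assign values. -/
abbrev Vert : Type := Bool × List RawClause × List ℕ

/-- The vertex of a block of clauses. -/
def blockVert (ℓ : ℕ) (L : List RawClause) (i : ℕ) : Vert :=
  (true, block ℓ L i, occs (block ℓ L i))

/-- The vertex of a group of variables. -/
def groupVert (ℓ n : ℕ) (L : List RawClause) (t : ℕ) : Vert := (false, [], groupVars ℓ n L t)

/-- The vertices: `ℓ` blocks of clauses and `ℓ` groups of variables. -/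
def verts (ℓ n : ℕ) (L : List RawClause) : List Vert :=
  (List.range ℓ).map (blockVert ℓ L) ++ (List.range ℓ).map (groupVert ℓ n L)

/-- The value that the bit string `a`, listing values of the variables in `V`, gives to `x`. -/
def look (V : List ℕ) (a : List Bool) (x : ℕ) : Bool :=
  (V.foldl (fun st v => (st.1.tail, if (v == x) = true then st.1.headD false else st.2))
    (a, false)).2

/-- Does the assignment satisfy the clause? -/
def rawTrue (v : ℕ → Bool) (c : RawClause) : Bool := (lits c).any fun l => v l.1 == l.2

/-- Does the letter `a` satisfy all the clauses at `U`? -/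
def vertOk (U : Vert) (a : List Bool) : Bool := U.2.1.all fun c => rawTrue (look U.2.2 a) c

/-- Do the letters `a` at `U` and `b` at `W` give the same values to common variables? -/
def agree (U W : Vert) (a b : List Bool) : Bool :=
  U.2.2.all fun x => !(W.2.2.any fun y => y == x) || look U.2.2 a x == look W.2.2 b x

/-- The constraint. -/
def rel (U W : Vert) (a b : List Bool) : Bool := (vertOk U a && vertOk W b) && agree U W a b

/-- The code of a pair of vertices. -/
def codePair (S : List (List Bool)) (U W : Vert) : List Bool :=
  (!(U.1 == W.1)) :: S.flatMap fun a => S.flatMap fun b => [rel U W a b]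

/-- The code of an instance with vertices `V` and alphabet `S`. -/
def codeCSP (V : List Vert) (S : List (List Bool)) : List Bool :=
  (List.replicate V.length true ++ [false]) ++ ((List.replicate S.length true ++ [false]) ++
    V.flatMap fun U => V.flatMap fun W => codePair S U W)

/-- A bound on the number of variables stored at a vertex. -/
def strLen (ℓ m : ℕ) : ℕ := 3 * (m / ℓ + (ℓ + 1) * ((ℓ + 1) * (ℓ + 1)))

/-- All bit strings of length `n`. -/
def strings (n : ℕ) : List (List Bool) :=
  (List.replicate n true).foldl (fun acc _ => acc.flatMap fun a => [false :: a, true :: a]) [[]]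

/-- A number of clauses from which on the blocks are balanced. -/
def manyClauses (ℓ : ℕ) : ℕ := 7 * ((ℓ + 1) * ((ℓ + 1) * ((ℓ + 1) * ((ℓ + 1) * (ℓ + 1)))))

/-- Repeat short lists of clauses. -/
def inflate (ℓ : ℕ) (L : List RawClause) : List RawClause :=
  if decide (L.length < manyClauses ℓ) = true then
    (List.range (manyClauses ℓ)).flatMap fun _ => L else L

/-- The state of the parser of formulas: the phase, the sign and the index of the current literal,
the last three literals, and the clauses so far. -/
abbrev ParseState : Type := ℕ × Bool × ℕ × RawClause × List RawClause

/-- Parsing a bit. -/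
def parseStep (s : ParseState) (b : Bool) : ParseState :=
  -- Phase 0 skips the unary header; phase 1 waits for the mark of a next clause; phases 2, 4, 6
  -- read the sign of a literal and phases 3, 5, 7 its unary index. Each finished literal is shifted
  -- into the window, which after phase 7 is the complete clause.
  if (s.1 == 0) = true then
    if b = true then s else (1, s.2)
  else if (s.1 == 1) = true then
    if b = true then (2, s.2) else s
  else if (s.1 == 2 || (s.1 == 4 || s.1 == 6)) = true then
    (s.1 + 1, b, 0, s.2.2.2)
  else if b = true then (s.1, s.2.1, s.2.2.1 + 1, s.2.2.2)
  else
    let w : RawClause := (s.2.2.2.1.2.1, s.2.2.2.1.2.2, (s.2.2.1, s.2.1))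
    if (s.1 == 7) = true then (1, s.2.1, 0, w, s.2.2.2.2 ++ [w])
    else (s.1 + 1, s.2.1, 0, w, s.2.2.2.2)

/-- The clauses of a formula given by a bit string. -/
def parse (x : List Bool) : List RawClause :=
  (x.foldl parseStep (0, false, 0, ((0, false), (0, false), (0, false)), [])).2.2.2.2

/-- The clauses that the reduction works with. -/
def workClauses (i : ℕ × List Bool) : List RawClause := inflate i.1 (parse i.2)

/-- The exponent of the size of the alphabet. -/
def alphExp (i : ℕ × List Bool) : ℕ := strLen i.1 (workClauses i).length

/-- The reduction, as a function of `ℓ` and of the bit string of a formula: the bit string of an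
instance and its number of vertices. -/
def reduction (i : ℕ × List Bool) : List Bool × ℕ :=
  (codeCSP (verts i.1 i.2.length (workClauses i)) (strings (alphExp i)), 2 * i.1)

/-! ### The reduction is computable in polynomial time -/

section
variable {α : Type} [Enc α]

@[fun_prop]
theorem polyTime_lits {f : α → RawClause} (hf : PolyTime f) : PolyTime fun x => lits (f x) := by
  unfold lits; fun_prop

@[fun_prop]
theorem polyTime_occs {f : α → List RawClause} (hf : PolyTime f) :
    PolyTime fun x => occs (f x) := by
  unfold occs; fun_prop

@[fun_prop]
theorem polyTime_occsBelow {f : α → List RawClause} {g : α → ℕ} (hf : PolyTime f)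
    (hg : PolyTime g) : PolyTime fun x => occsBelow (f x) (g x) := by
  unfold occsBelow; fun_prop

@[fun_prop]
theorem polyTime_occsUpTo {f : α → List RawClause} {g : α → ℕ} (hf : PolyTime f)
    (hg : PolyTime g) : PolyTime fun x => occsUpTo (f x) (g x) := by
  unfold occsUpTo; fun_prop

@[fun_prop]
theorem polyTime_groupWidth {f : α → ℕ} {g : α → List RawClause} (hf : PolyTime f)
    (hg : PolyTime g) : PolyTime fun x => groupWidth (f x) (g x) := by
  unfold groupWidth; fun_prop

@[fun_prop]
theorem polyTime_groupOf {f : α → ℕ} {g : α → List RawClause} {h : α → ℕ} (hf : PolyTime f)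
    (hg : PolyTime g) (hh : PolyTime h) : PolyTime fun x => groupOf (f x) (g x) (h x) := by
  unfold groupOf; fun_prop

@[fun_prop]
theorem polyTime_clauseType {f : α → ℕ} {g : α → List RawClause} {h : α → RawClause}
    (hf : PolyTime f) (hg : PolyTime g) (hh : PolyTime h) :
    PolyTime fun x => clauseType (f x) (g x) (h x) := by
  unfold clauseType; fun_prop

@[fun_prop]
theorem polyTime_typeEq {f g : α → ℕ × ℕ × ℕ} (hf : PolyTime f) (hg : PolyTime g) :
    PolyTime fun x => typeEq (f x) (g x) := by
  unfold typeEq; fun_prop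

theorem dealOut_append (ℓ : ℕ) (L L' : List RawClause) (c : RawClause) :
    dealOut ℓ L (L' ++ [c]) = dealOut ℓ L L' ++ [(c, (dealOut ℓ L L').countP
      (fun p => typeEq (clauseType ℓ L p.1) (clauseType ℓ L c)) % ℓ)] := by
  simp [dealOut]

theorem map_fst_dealOut (ℓ : ℕ) (L L' : List RawClause) :
    (dealOut ℓ L L').map (fun p => p.1) = L' := by
  induction L' using List.reverseRecOn with
  | nil => rfl
  | append_singleton l c ih => rw [dealOut_append, List.map_append, ih]; rfl

theorem length_dealOut (ℓ : ℕ) (L L' : List RawClause) :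
    (dealOut ℓ L L').length = L'.length := by
  rw [← List.length_map (f := fun p => p.1), map_fst_dealOut]

theorem mem_dealOut {ℓ : ℕ} {L L' : List RawClause} {p : RawClause × ℕ}
    (hp : p ∈ dealOut ℓ L L') : p.1 ∈ L' ∧ p.2 ≤ L'.length := by
  induction L' using List.reverseRecOn with
  | nil => simp [dealOut] at hp
  | append_singleton l c ih =>
    rw [dealOut_append, List.mem_append] at hp
    rcases hp with hp | hp
    · obtain ⟨h1, h2⟩ := ih hp
      exact ⟨List.mem_append_left _ h1, by rw [List.length_append]; omega⟩
    · rw [List.mem_singleton] at hp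
      subst hp
      refine ⟨by simp, (Nat.mod_le _ _).trans (List.countP_le_length.trans ?_)⟩
      rw [length_dealOut, List.length_append]
      omega

theorem sz_bool (b : Bool) : sz b ≤ 3 := by
  cases b <;> simp [sz, enc, Data.ofBit, Data.size]

theorem sz_dealOut_le (ℓ : ℕ) (L L' : List RawClause) :
    sz (dealOut ℓ L L') ≤ L'.length * (sz L' + (4 * L'.length + 1) + 2) + 1 := by
  rw [← length_dealOut ℓ L L']
  refine (sz_le_length_mul _ (B := sz L' + (4 * (dealOut ℓ L L').length + 1) + 1)
    fun p hp => ?_).trans le_rfl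
  obtain ⟨h1, h2⟩ := mem_dealOut hp
  have := sz_le_of_mem h1
  rw [sz_prod, sz_nat, length_dealOut]
  omega

@[fun_prop]
theorem polyTime_dealOut {f : α → ℕ} {g h : α → List RawClause}
    (hf : PolyTime f) (hg : PolyTime g) (hh : PolyTime h) :
    PolyTime fun x => dealOut (f x) (g x) (h x) := by
  obtain ⟨P, hP⟩ := hh.exists_sz_le
  unfold dealOut
  refine PolyTime.foldl (h := fun x (acc : List (RawClause × ℕ)) c => acc ++ [(c, acc.countP
    (fun p => typeEq (clauseType (f x) (g x) p.1) (clauseType (f x) (g x) c)) % (f x))])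
    hh (PolyTime.const []) (by fun_prop) (P * (P + (4 * P + 1) + 2) + 1) fun x l hl => ?_
  refine (sz_dealOut_le (f x) (g x) l).trans ?_
  have h1 := sz_le_of_prefix hl
  have h2 := hP x
  have h3 := length_le_sz l
  simp only [Polynomial.eval_add, Polynomial.eval_mul, Polynomial.eval_one, Polynomial.eval_ofNat]
  gcongr <;> omega

@[fun_prop]
theorem polyTime_block {f : α → ℕ} {g : α → List RawClause} {h : α → ℕ}
    (hf : PolyTime f) (hg : PolyTime g) (hh : PolyTime h) :
    PolyTime fun x => block (f x) (g x) (h x) := by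
  unfold block; fun_prop

@[fun_prop]
theorem polyTime_groupVars {f g : α → ℕ} {h : α → List RawClause} {k : α → ℕ}
    (hf : PolyTime f) (hg : PolyTime g) (hh : PolyTime h) (hk : PolyTime k) :
    PolyTime fun x => groupVars (f x) (g x) (h x) (k x) := by
  unfold groupVars; fun_prop

theorem polyTime_verts {f g : α → ℕ} {h : α → List RawClause}
    (hf : PolyTime f) (hg : PolyTime g) (hh : PolyTime h) :
    PolyTime fun x => verts (f x) (g x) (h x) := by
  unfold verts blockVert groupVert; fun_prop

@[fun_prop]
theorem polyTime_look {f : α → List ℕ} {g : α → List Bool} {h : α → ℕ}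
    (hf : PolyTime f) (hg : PolyTime g) (hh : PolyTime h) :
    PolyTime fun x => look (f x) (g x) (h x) := by
  unfold look
  obtain ⟨P, hP⟩ := hg.exists_sz_le
  refine PolyTime.snd (PolyTime.foldl (h := fun x (st : List Bool × Bool) v => (st.1.tail,
    if (v == h x) = true then st.1.headD false else st.2)) hf (hg.prodMk (PolyTime.const false))
    (by fun_prop) (P + 4) fun x l hl => ?_)
  -- The accumulator stays small because the string of remaining values only shrinks.
  have key (st : List Bool × Bool) : sz (l.foldl (fun (st : List Bool × Bool) v => (st.1.tail,
      if (v == h x) = true then st.1.headD false else st.2)) st).1 ≤ sz st.1 := by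
    clear hl
    induction l generalizing st with
    | nil => exact le_rfl
    | cons v l ih =>
      refine (ih _).trans ?_
      dsimp only
      cases st.1 with
      | nil => exact le_rfl
      | cons b a => rw [sz_cons, List.tail_cons]; omega
  have h1 := key (g x, false)
  have h2 := sz_bool (l.foldl (fun (st : List Bool × Bool) v => (st.1.tail,
      if (v == h x) = true then st.1.headD false else st.2)) (g x, false)).2
  have h3 := hP x
  dsimp only at h1
  rw [sz_prod, Polynomial.eval_add, Polynomial.eval_ofNat]
  omega

@[fun_prop]
theorem polyTime_rel {f g : α → Vert} {h k : α → List Bool}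
    (hf : PolyTime f) (hg : PolyTime g) (hh : PolyTime h) (hk : PolyTime k) :
    PolyTime fun x => rel (f x) (g x) (h x) (k x) := by
  unfold rel vertOk agree rawTrue; fun_prop

@[fun_prop]
theorem polyTime_codeCSP {f : α → List Vert} {g : α → List (List Bool)}
    (hf : PolyTime f) (hg : PolyTime g) : PolyTime fun x => codeCSP (f x) (g x) := by
  unfold codeCSP codePair; fun_prop

@[fun_prop]
theorem polyTime_manyClauses {f : α → ℕ} (hf : PolyTime f) :
    PolyTime fun x => manyClauses (f x) := by
  unfold manyClauses; fun_prop

theorem polyTime_inflate {f : α → ℕ} {g : α → List RawClause} (hf : PolyTime f)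
    (hg : PolyTime g) : PolyTime fun x => inflate (f x) (g x) := by
  unfold inflate; fun_prop

/-! ### Size bounds for the parser, and polynomial time of its output. -/

/-- The variables of a clause are at most `n`. -/
def ClauseBound (n : ℕ) (c : RawClause) : Prop := c.1.1 ≤ n ∧ c.2.1.1 ≤ n ∧ c.2.2.1 ≤ n

theorem ClauseBound.mono {m n : ℕ} {c : RawClause} (h : ClauseBound m c) (hmn : m ≤ n) :
    ClauseBound n c := ⟨h.1.trans hmn, h.2.1.trans hmn, h.2.2.trans hmn⟩

theorem ClauseBound.sz_le {n : ℕ} {c : RawClause} (h : ClauseBound n c) :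
    sz c ≤ 12 * n + 17 := by
  obtain ⟨h1, h2, h3⟩ := h
  have h4 := sz_bool c.1.2
  have h5 := sz_bool c.2.1.2
  have h6 := sz_bool c.2.2.2
  simp only [sz_prod, sz_nat]
  omega

/-- The numbers in the state `s` of the parser are at most `n`. -/
structure ParseBound (n : ℕ) (s : ParseState) : Prop where
  phase : s.1 ≤ n
  idx : s.2.2.1 ≤ n
  window : ClauseBound n s.2.2.2.1
  out : ∀ c ∈ s.2.2.2.2, ClauseBound n c
  len : s.2.2.2.2.length ≤ n

/-- One bit raises each counter by at most one and adds at most one clause, so after n bits all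
numbers are at most n and the state has size O(n²). -/
theorem ParseBound.step {n : ℕ} {s : ParseState} (h : ParseBound n s) (b : Bool) :
    ParseBound (n + 1) (parseStep s b) := by
  obtain ⟨ph, sg, ix, w, out⟩ := s
  obtain ⟨h1, h2, h3, h4, h5⟩ := h
  dsimp only at h1 h2 h3 h4 h5
  have h3' := h3.mono (Nat.le_succ n)
  have h4' : ∀ c ∈ out, ClauseBound (n + 1) c := fun c hc => (h4 c hc).mono (Nat.le_succ n)
  have hw : ClauseBound (n + 1) (w.2.1, w.2.2, (ix, sg)) := ⟨h3'.2.1, h3'.2.2, by simp; omega⟩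
  unfold parseStep
  dsimp only
  split_ifs with c1 c2 c2 c3 c4 c5 c6
  all_goals try
    refine ⟨?_, ?_, ‹_›, ‹_›, ?_⟩ <;> dsimp only <;> simp at * <;> omega
  refine ⟨by simp, by simp, hw, ?_, by simp; omega⟩
  intro c hc
  rcases List.mem_append.1 hc with hc | hc
  · exact h4' c hc
  · rw [List.mem_singleton.1 hc]
    exact hw

theorem ParseBound.foldl (l : List Bool) {n : ℕ} {s : ParseState} (h : ParseBound n s) :
    ParseBound (n + l.length) (l.foldl parseStep s) := by
  induction l generalizing n s with
  | nil => exact h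
  | cons b l ih =>
    have := ih (h.step b)
    rwa [List.length_cons, Nat.add_comm l.length, ← Nat.add_assoc]

theorem ParseBound.sz_le {n : ℕ} {s : ParseState} (h : ParseBound n s) :
    sz s ≤ n * (12 * n + 18) + 20 * n + 27 := by
  obtain ⟨ph, sg, ix, w, out⟩ := s
  obtain ⟨h1, h2, h3, h4, h5⟩ := h
  dsimp only at h1 h2 h3 h4 h5
  have h6 := h3.sz_le
  have h7 : sz out ≤ out.length * (12 * n + 18) + 1 :=
    sz_le_length_mul out fun c hc => (h4 c hc).sz_le
  have h8 := Nat.mul_le_mul_right (12 * n + 18) h5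
  have h9 := sz_bool sg
  simp only [sz_prod (α := ℕ) (β := Bool × ℕ × RawClause × List RawClause),
    sz_prod (α := Bool) (β := ℕ × RawClause × List RawClause),
    sz_prod (α := ℕ) (β := RawClause × List RawClause),
    sz_prod (α := RawClause) (β := List RawClause), sz_nat]
  omega

theorem polyTime_parse {f : α → List Bool} (hf : PolyTime f) : PolyTime fun x => parse (f x) := by
  unfold parse
  obtain ⟨P, hP⟩ := hf.exists_sz_le
  refine PolyTime.snd (PolyTime.snd (PolyTime.snd (PolyTime.snd
    (PolyTime.foldl (h := fun _ => parseStep) hf (PolyTime.const _) ?_ (P ^ 2 * 100 + 100)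
      fun x l hl => ?_))))
  · unfold parseStep; fun_prop
  · have h0 := ParseBound.foldl l (s := (0, false, 0, ((0, false), (0, false), (0, false)), []))
      (n := 0) ⟨le_rfl, le_rfl, ⟨le_rfl, le_rfl, le_rfl⟩, by simp, le_rfl⟩
    have h1 := h0.sz_le
    have h2 : l.length ≤ P.eval (sz x) :=
      hl.length_le.trans ((length_le_sz _).trans (hP x))
    rw [zero_add] at h1
    simp only [Polynomial.eval_add, Polynomial.eval_mul, Polynomial.eval_pow,
      Polynomial.eval_ofNat]
    have h3 := Nat.pow_le_pow_left h2 2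
    nlinarith [sq_nonneg ((l.length : ℤ) - 1)]

theorem polyTime_workClauses : PolyTime workClauses := by
  unfold workClauses
  exact polyTime_inflate (by fun_prop) (polyTime_parse (by fun_prop))

theorem polyTime_alphExp : PolyTime alphExp := by
  have := polyTime_workClauses
  unfold alphExp strLen
  fun_prop

end

/-! ### The alphabet -/

theorem strings_succ (n : ℕ) :
    strings (n + 1) = (strings n).flatMap fun a => [false :: a, true :: a] := by
  simp [strings, List.replicate_succ']

theorem length_strings (n : ℕ) : (strings n).length = 2 ^ n := by
  induction n with
  | zero => rfl
  | succ n ih => simp [strings_succ, List.length_flatMap, ih, pow_succ]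

theorem mem_strings {n : ℕ} {a : List Bool} : a ∈ strings n ↔ a.length = n := by
  induction n generalizing a with
  | zero => simp [strings]
  | succ n ih =>
    rw [strings_succ, List.mem_flatMap]
    constructor
    · rintro ⟨b, hb, h⟩
      have := ih.1 hb
      simp only [List.mem_cons, List.not_mem_nil, or_false] at h
      rcases h with rfl | rfl <;> simp [this]
    · cases a with
      | nil => simp
      | cons b a =>
        intro h
        refine ⟨a, ih.2 (by simpa using h), ?_⟩
        cases b <;> simp

theorem sz_strings_le (n : ℕ) : sz (strings n) ≤ 2 ^ n * (4 * n + 2) + 1 := by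
  rw [← length_strings n]
  refine sz_le_length_mul _ fun a ha => ?_
  rw [← mem_strings.1 ha]
  refine (sz_le_length_mul a fun b _ => sz_bool b).trans ?_
  omega

/-- There are 2^`alphExp` strings, so the time is measured against the input size plus this number.
Every intermediate list is the list of all strings of a smaller length. -/
theorem polyTimeIn_strings : PolyTimeIn (fun i : ℕ × List Bool => sz i + 2 ^ alphExp i)
    fun i => strings (alphExp i) := by
  have hμ (i : ℕ × List Bool) : sz i ≤ sz i + 2 ^ alphExp i := Nat.le_add_right _ _
  refine PolyTimeIn.foldl (h := fun _ (acc : List (List Bool)) (_ : Bool) =>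
    acc.flatMap fun a => [false :: a, true :: a]) hμ
    (polyTime_alphExp.replicate_true.toPolyTimeIn hμ) ((PolyTime.const [[]]).toPolyTimeIn hμ)
    (by fun_prop) (.X * (4 * .X + 2) + 1) fun i l hl => ?_
  have h1 : l = List.replicate l.length true :=
    List.eq_replicate_iff.2 ⟨rfl, fun b hb => List.eq_of_mem_replicate (hl.subset hb)⟩
  have h2 := hl.length_le
  rw [List.length_replicate] at h2
  have h3 := sz_strings_le l.length
  unfold strings at h3
  rw [← h1] at h3
  refine h3.trans ?_
  simp only [Polynomial.eval_add, Polynomial.eval_mul, Polynomial.eval_X, Polynomial.eval_one,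
    Polynomial.eval_ofNat]
  have h4 : 2 ^ l.length ≤ sz i + 2 ^ alphExp i :=
    (Nat.pow_le_pow_right (by norm_num) h2).trans (Nat.le_add_left _ _)
  have h5 : l.length ≤ sz i + 2 ^ alphExp i :=
    (Nat.lt_two_pow_self.le).trans h4
  gcongr

theorem polyTimeIn_reduction :
    PolyTimeIn (fun i : ℕ × List Bool => sz i + 2 ^ alphExp i) reduction := by
  have hμ (i : ℕ × List Bool) : sz i ≤ sz i + 2 ^ alphExp i := Nat.le_add_right _ _
  have h1 : PolyTime fun i : ℕ × List Bool => verts i.1 i.2.length (workClauses i) :=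
    polyTime_verts (by fun_prop) (by fun_prop) polyTime_workClauses
  have h2 := (h1.toPolyTimeIn hμ).prodMk polyTimeIn_strings
  have h3 : PolyTime fun p : List Vert × List (List Bool) => codeCSP p.1 p.2 := by fun_prop
  have h4 : PolyTime fun i : ℕ × List Bool => 2 * i.1 := by fun_prop
  exact (h2.comp h3).prodMk (h4.toPolyTimeIn hμ)

/-! ### Parsing -/

/-- A clause without the bound on its variables. -/
def toRaw {n : ℕ} (c : Clause n) : RawClause :=
  ((c.1.1, c.1.2), (c.2.1.1, c.2.1.2), (c.2.2.1, c.2.2.2))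

theorem foldl_parseStep_replicate {p : ℕ} (hp : p = 3 ∨ p = 5 ∨ p = 7) (k : ℕ) (sg : Bool)
    (ix : ℕ) (w : RawClause) (out : List RawClause) :
    (List.replicate k true).foldl parseStep (p, sg, ix, w, out) = (p, sg, ix + k, w, out) := by
  induction k generalizing ix with
  | zero => rfl
  | succ k ih =>
    have : parseStep (p, sg, ix, w, out) true = (p, sg, ix + 1, w, out) := by
      rcases hp with rfl | rfl | rfl <;> simp [parseStep]
    rw [List.replicate_succ, List.foldl_cons, this, ih, Nat.add_right_comm, Nat.add_assoc]

theorem foldl_parseStep_lit {n p : ℕ} (hp : p = 2 ∨ p = 4) (l : Literal n) (sg : Bool)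
    (ix : ℕ) (w : RawClause) (out : List RawClause) :
    (CNF3.encodeLit l).foldl parseStep (p, sg, ix, w, out) =
      (p + 2, l.2, 0, (w.2.1, w.2.2, ((l.1 : ℕ), l.2)), out) := by
  have h1 : parseStep (p, sg, ix, w, out) l.2 = (p + 1, l.2, 0, w, out) := by
    rcases hp with rfl | rfl <;> simp [parseStep]
  have h2 (j : ℕ) : parseStep (p + 1, l.2, j, w, out) false =
      (p + 2, l.2, 0, (w.2.1, w.2.2, (j, l.2)), out) := by
    rcases hp with rfl | rfl <;> simp [parseStep]
  rw [CNF3.encodeLit, unary, List.foldl_cons, h1, List.foldl_append,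
    foldl_parseStep_replicate (by omega), List.foldl_cons, List.foldl_nil, h2, zero_add]

theorem foldl_parseStep_last {n : ℕ} (l : Literal n) (sg : Bool)
    (ix : ℕ) (w : RawClause) (out : List RawClause) :
    (CNF3.encodeLit l).foldl parseStep (6, sg, ix, w, out) =
      (1, l.2, 0, (w.2.1, w.2.2, ((l.1 : ℕ), l.2)), out ++ [(w.2.1, w.2.2, ((l.1 : ℕ), l.2))]) := by
  have h1 : parseStep (6, sg, ix, w, out) l.2 = (7, l.2, 0, w, out) := by simp [parseStep]
  have h2 (j : ℕ) : parseStep (7, l.2, j, w, out) false =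
      (1, l.2, 0, (w.2.1, w.2.2, (j, l.2)), out ++ [(w.2.1, w.2.2, (j, l.2))]) := by
    simp [parseStep]
  rw [CNF3.encodeLit, unary, List.foldl_cons, h1, List.foldl_append,
    foldl_parseStep_replicate (by omega), List.foldl_cons, List.foldl_nil, h2, zero_add]

theorem foldl_parseStep_clauses {n : ℕ} (l : List (Clause n)) (sg : Bool) (ix : ℕ)
    (w : RawClause) (out : List RawClause) :
    ((CNF3.encodeClauses l).foldl parseStep (1, sg, ix, w, out)).2.2.2.2 = out ++ l.map toRaw := by
  induction l generalizing sg ix w out with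
  | nil => simp [CNF3.encodeClauses, parseStep]
  | cons c l ih =>
    have h1 : parseStep (1, sg, ix, w, out) true = (2, sg, ix, w, out) := by simp [parseStep]
    rw [CNF3.encodeClauses, List.foldl_cons, h1, List.foldl_append, CNF3.encodeClause,
      List.foldl_append, List.foldl_append, foldl_parseStep_lit (p := 2) (by omega),
      foldl_parseStep_lit (p := 4) (by omega), foldl_parseStep_last, ih]
    simp [toRaw]

theorem parse_encode (F : CNF3) : parse F.encode = F.clauses.map toRaw := by
  have h1 (k : ℕ) (s : ParseState) (hs : s.1 = 0) :
      (List.replicate k true).foldl parseStep s = s := by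
    induction k with
    | zero => rfl
    | succ k ih =>
      have : parseStep s true = s := by simp [parseStep, hs]
      rw [List.replicate_succ, List.foldl_cons, this, ih]
  have h2 (r : Bool × ℕ × RawClause × List RawClause) : parseStep (0, r) false = (1, r) := by
    simp [parseStep]
  rw [parse, CNF3.encode, unary, List.foldl_append, List.foldl_append, h1 _ _ rfl,
    List.foldl_cons, h2, List.foldl_nil, foldl_parseStep_clauses, List.nil_append]

/-! ### The instance -/

theorem agree_iff {U W : Vert} {a b : List Bool} :
    agree U W a b = true ↔ ∀ x ∈ U.2.2, x ∈ W.2.2 → look U.2.2 a x = look W.2.2 b x := by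
  simp only [agree, List.all_eq_true, Bool.or_eq_true, Bool.not_eq_true', List.any_eq_false,
    beq_iff_eq]
  refine forall₂_congr fun x _ => ⟨fun h hx => h.resolve_left fun h => h x hx rfl, fun h => ?_⟩
  by_cases hx : x ∈ W.2.2
  · exact Or.inr (h hx)
  · exact Or.inl fun y hy hxy => hx (hxy ▸ hy)

/-- Although `agree` scans the variables of one endpoint only, it is a condition on the common
variables and therefore symmetric. -/
theorem rel_comm (U W : Vert) (a b : List Bool) : rel U W a b = rel W U b a := by
  rw [rel, rel, Bool.and_comm (vertOk U a)]
  congr 1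
  rw [Bool.eq_iff_iff, agree_iff, agree_iff]
  exact ⟨fun h x hx hx' => (h x hx' hx).symm, fun h x hx hx' => (h x hx' hx).symm⟩

/-- The instance of 2CSP with vertices `V` and alphabet `S`. -/
def mkCSP (V : List Vert) (S : List (List Bool)) (hS : 0 < S.length) : TwoCSP where
  numVars := V.length
  alphSize := S.length
  alphSize_pos := hS
  graph :=
    { Adj := fun u v => (V.get u).1 ≠ (V.get v).1
      symm := ⟨fun _ _ h => h.symm⟩
      loopless := ⟨fun _ h => h rfl⟩ }
  con := fun u v a b => rel (V.get u) (V.get v) (S.get a) (S.get b)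
  con_symm := fun _ _ _ _ => rel_comm _ _ _ _

theorem flatMap_finRange_get {σ τ : Type*} (l : List σ) (f : σ → List τ) :
    ((List.finRange l.length).flatMap fun i => f (l.get i)) = l.flatMap f := by
  rw [← List.flatMap_map, List.map_get_finRange]

theorem encode_mkCSP (V : List Vert) (S : List (List Bool)) (hS : 0 < S.length) :
    (mkCSP V S hS).encode = codeCSP V S := by
  unfold TwoCSP.encode codeCSP
  have hp (u v : Fin V.length) :
      (mkCSP V S hS).encodePair u v = codePair S (V.get u) (V.get v) := by
    unfold TwoCSP.encodePair codePair
    congr 1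
    · by_cases h : (V.get u).1 = (V.get v).1
      · rw [beq_iff_eq.2 h]
        classical exact decide_eq_false (not_not.2 h)
      · rw [beq_eq_false_iff_ne.2 h]
        classical exact decide_eq_true h
    · rw [← flatMap_finRange_get S (fun a => S.flatMap fun b => [rel (V.get u) (V.get v) a b])]
      simp only [← flatMap_finRange_get S (fun b => [rel (V.get u) (V.get v) _ b])]
      rfl
  rw [unary, unary]
  congr 2
  rw [← flatMap_finRange_get V (fun U => V.flatMap fun W => codePair S U W)]
  simp only [← flatMap_finRange_get V (fun W => codePair S _ W), ← hp]
  rfl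

theorem length_verts (ℓ n : ℕ) (L : List RawClause) : (verts ℓ n L).length = 2 * ℓ := by
  simp [verts, two_mul]

/-! ### The groups of variables -/

theorem length_occs (L : List RawClause) : (occs L).length = 3 * L.length := by
  simp [occs, lits, List.length_flatMap, mul_comm]

section
variable {ℓ : ℕ} (hℓ : 0 < ℓ) {L : List RawClause}
include hℓ

/-- The `+ 1` in `groupWidth` makes ℓ times the width exceed the number of occurrences, so ℓ
intervals suffice and the value ℓ is free to mark heavy variables. -/
theorem occsBelow_div_lt (x : ℕ) : occsBelow L x / groupWidth ℓ L < ℓ := by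
  apply Nat.div_lt_of_lt_mul
  have h1 : occsBelow L x ≤ (occs L).length := List.countP_le_length
  have h2 := Nat.lt_mul_div_succ (occs L).length hℓ
  rw [groupWidth, mul_comm]
  omega

theorem groupOf_le (x : ℕ) : groupOf ℓ L x ≤ ℓ := by
  unfold groupOf
  split
  · exact le_rfl
  · exact (occsBelow_div_lt hℓ x).le

theorem groupOf_eq_iff (x : ℕ) : groupOf ℓ L x = ℓ ↔
    occsBelow L x / groupWidth ℓ L < (occsUpTo L x - 1) / groupWidth ℓ L := by
  have := occsBelow_div_lt hℓ (L := L) x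
  unfold groupOf
  split <;> rename_i h <;> simp only [decide_eq_true_eq] at h
  · simp [h]
  · simp [h]; omega

omit hℓ in
theorem occsUpTo_le_occsBelow {x y : ℕ} (h : x < y) : occsUpTo L x ≤ occsBelow L y :=
  List.countP_mono_left fun z _ hz => by simp only [decide_eq_true_eq] at *; omega

/-- The last occurrence of a heavy variable lies in a later interval than its first one, and a
larger variable starts no earlier than that. Hence the interval of the start is strictly increasing
on heavy variables, and it takes values below ℓ. -/
theorem length_filter_groupOf_eq (n : ℕ) :
    ((List.range n).filter fun x => groupOf ℓ L x == ℓ).length ≤ ℓ := by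
  have hlt {x y : ℕ} (hx : groupOf ℓ L x = ℓ) (hxy : x < y) :
      occsBelow L x / groupWidth ℓ L < occsBelow L y / groupWidth ℓ L :=
    ((groupOf_eq_iff hℓ x).1 hx).trans_le
      (Nat.div_le_div_right ((Nat.sub_le _ _).trans (occsUpTo_le_occsBelow hxy)))
  rw [← List.toFinset_card_of_nodup ((List.nodup_range).filter _)]
  conv_rhs => rw [← Finset.card_range ℓ]
  refine Finset.card_le_card_of_injOn (fun x => occsBelow L x / groupWidth ℓ L)
    (fun x _ => by simpa using occsBelow_div_lt hℓ x) ?_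
  intro x hx y hy hxy
  simp only [List.coe_toFinset, List.mem_filter, beq_iff_eq, Set.mem_ofPred_eq] at hx hy
  rcases lt_trichotomy x y with h | h | h
  · exact absurd hxy (hlt hx.2 h).ne
  · exact h
  · exact absurd hxy (hlt hy.2 h).ne'

-- The entries satisfying `P` lie in [a, b] and are thus disjoint from those below a; both kinds are
-- at most b.
omit hℓ in
theorem countP_add_occsBelow_le (l : List ℕ) {P : ℕ → Bool} {a b : ℕ} (hab : a ≤ b)
    (h : ∀ y ∈ l, P y = true → a ≤ y ∧ y ≤ b) :
    l.countP P + l.countP (fun y => decide (y < a)) ≤ l.countP fun y => decide (y ≤ b) := by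
  induction l with
  | nil => simp
  | cons y l ih =>
    have h1 := ih fun z hz => h z (by simp [hz])
    have h2 := h y (by simp)
    simp only [List.countP_cons, decide_eq_true_eq]
    split_ifs with c1 c2 c3 c3 <;> first | omega | (have := h2 ‹_›; omega)

/-- All variables of group t lie between its least member a and its greatest member b. The
occurrences of a start inside interval t and those of b end inside it, so all of them fit into one
interval. -/
theorem countP_groupOf_le {t : ℕ} (ht : t < ℓ) :
    (occs L).countP (fun x => groupOf ℓ L x == t) ≤ groupWidth ℓ L := by
  set S := (occs L).toFinset.filter fun x => groupOf ℓ L x = t with hS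
  have hw : 0 < groupWidth ℓ L := Nat.succ_pos _
  have hlight {x : ℕ} (hx : groupOf ℓ L x = t) : occsBelow L x / groupWidth ℓ L = t ∧
      (occsUpTo L x - 1) / groupWidth ℓ L ≤ t := by
    have h1 : ¬ groupOf ℓ L x = ℓ := by omega
    rw [groupOf_eq_iff hℓ] at h1
    have h2 : groupOf ℓ L x = occsBelow L x / groupWidth ℓ L := by
      unfold groupOf
      rw [if_neg (by simpa using h1)]
    omega
  rcases S.eq_empty_or_nonempty with he | hne
  · rw [List.countP_eq_zero.2]
    · exact Nat.zero_le _
    · intro x hx hx'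
      have : x ∈ S := by simp_all
      simp [he] at this
  · have ha := S.min'_mem hne
    have hb := S.max'_mem hne
    set a := S.min' hne
    set b := S.max' hne
    have h := countP_add_occsBelow_le (occs L) (P := fun x => groupOf ℓ L x == t)
      (S.min'_le b hb) fun y hy hy' => by
        have : y ∈ S := by simpa [hS, hy] using hy'
        exact ⟨S.min'_le y this, S.le_max' y this⟩
    have h1 := (hlight (Finset.mem_filter.1 ha).2).1
    have h2 := (hlight (Finset.mem_filter.1 hb).2).2
    have h3 := Nat.div_mul_le_self (occsBelow L a) (groupWidth ℓ L)
    have h4 := Nat.lt_mul_of_div_lt (Nat.lt_succ_of_le h2) hw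
    rw [h1] at h3
    rw [Nat.succ_mul] at h4
    change _ + occsBelow L a ≤ occsUpTo L b at h
    omega

/-! ### The blocks of clauses -/

omit hℓ in
theorem typeEq_iff {τ τ' : ℕ × ℕ × ℕ} : typeEq τ τ' = true ↔ τ = τ' := by
  simp [typeEq, Prod.ext_iff]

theorem snd_lt_of_mem_dealOut {L' : List RawClause} {p : RawClause × ℕ}
    (hp : p ∈ dealOut ℓ L L') : p.2 < ℓ := by
  induction L' using List.reverseRecOn with
  | nil => simp [dealOut] at hp
  | append_singleton l c ih =>
    rw [dealOut_append, List.mem_append] at hp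
    rcases hp with hp | hp
    · exact ih hp
    · rw [List.mem_singleton] at hp
      subst hp
      exact Nat.mod_lt _ hℓ

-- The j-th clause of a type, counted from 0, receives the number j mod ℓ; counting the clauses of
-- this type with number i is therefore counting residues.
omit hℓ in
theorem countP_dealOut (L' : List RawClause) (τ : ℕ × ℕ × ℕ) (i : ℕ) :
    (dealOut ℓ L L').countP (fun p => typeEq (clauseType ℓ L p.1) τ && p.2 == i) =
      Nat.count (fun j => j % ℓ = i) (L'.countP fun c => typeEq (clauseType ℓ L c) τ) := by
  induction L' using List.reverseRecOn with
  | nil => simp [dealOut]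
  | append_singleton l c ih =>
    rw [dealOut_append, List.countP_append, ih, List.countP_append]
    by_cases h : clauseType ℓ L c = τ
    · have h1 : (dealOut ℓ L l).countP (fun p => typeEq (clauseType ℓ L p.1) τ) =
          l.countP fun c => typeEq (clauseType ℓ L c) τ := by
        conv_rhs => rw [← map_fst_dealOut ℓ L l, List.countP_map]
        rfl
      rw [List.countP_singleton, List.countP_singleton, if_pos (typeEq_iff.2 h), Nat.count_succ,
        h, h1, typeEq_iff.2 rfl]
      simp
    · have h2 : typeEq (clauseType ℓ L c) τ = false := by
        rw [← Bool.not_eq_true, typeEq_iff]; exact h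
      simp [h2]

/-- Among N consecutive numbers at most N/ℓ + 1 have a given residue mod ℓ. -/
theorem mul_countP_block_le (τ : ℕ × ℕ × ℕ) (i : ℕ) :
    ℓ * (block ℓ L i).countP (fun c => typeEq (clauseType ℓ L c) τ) ≤
      L.countP (fun c => typeEq (clauseType ℓ L c) τ) + ℓ := by
  rw [block, List.countP_map, List.countP_filter]
  have h := countP_dealOut (ℓ := ℓ) (L := L) L τ i
  have h' : (dealOut ℓ L L).countP (fun p => ((fun c => typeEq (clauseType ℓ L c) τ) ∘
      fun p : RawClause × ℕ => p.1) p && p.2 == i) = _ := h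
  rw [h']
  generalize L.countP (fun c => typeEq (clauseType ℓ L c) τ) = N
  by_cases hi : i < ℓ
  · have h1 : (fun j => j % ℓ = i) = fun j => j ≡ i [MOD ℓ] := by
      funext j
      rw [Nat.ModEq, Nat.mod_eq_of_lt hi]
    have h2 : Nat.count (fun j => j % ℓ = i) N ≤ N / ℓ + 1 := by
      simp only [h1]
      rw [Nat.count_modEq_card _ hℓ]
      split <;> omega
    have h3 := Nat.mul_div_le N ℓ
    calc _ ≤ ℓ * (N / ℓ + 1) := Nat.mul_le_mul_left _ h2
      _ ≤ _ := by rw [Nat.mul_add]; omega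
  · have h1 : Nat.count (fun j => j % ℓ = i) N = 0 := by
      rw [Nat.count_iff_forall_not]
      intro j _ hj
      exact hi (hj ▸ Nat.mod_lt _ hℓ)
    rw [h1]
    omega

/-- The possible types of clauses. -/
def clauseTypes (ℓ : ℕ) : Finset (ℕ × ℕ × ℕ) :=
  Finset.range (ℓ + 1) ×ˢ Finset.range (ℓ + 1) ×ˢ Finset.range (ℓ + 1)

omit hℓ in
theorem card_clauseTypes : (clauseTypes ℓ).card = (ℓ + 1) * ((ℓ + 1) * (ℓ + 1)) := by
  simp [clauseTypes]

theorem clauseType_mem (c : RawClause) : clauseType ℓ L c ∈ clauseTypes ℓ := by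
  simp only [clauseTypes, clauseType, Finset.mem_product, Finset.mem_range, Nat.lt_succ_iff]
  exact ⟨groupOf_le hℓ _, groupOf_le hℓ _, groupOf_le hℓ _⟩

theorem sum_map_clauseType (φ : ℕ × ℕ × ℕ → ℕ) (l : List RawClause) :
    (l.map fun c => φ (clauseType ℓ L c)).sum =
      ∑ τ ∈ clauseTypes ℓ, φ τ * l.countP fun c => typeEq (clauseType ℓ L c) τ := by
  induction l with
  | nil => simp
  | cons c l ih =>
    simp only [List.map_cons, List.sum_cons, ih, List.countP_cons, mul_add, mul_ite, mul_one,
      mul_zero, Finset.sum_add_distrib, typeEq_iff, Finset.sum_ite_eq, clauseType_mem hℓ, if_true]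
    exact add_comm _ _

/-- The balancing principle: any weight that depends only on the type of a clause is split almost
evenly among the blocks, with an error of at most one clause per type. It is applied to the weight 1
and to the number of occurrences from a fixed group. -/
theorem mul_sum_block_le (φ : ℕ × ℕ × ℕ → ℕ) (i : ℕ) :
    ℓ * ((block ℓ L i).map fun c => φ (clauseType ℓ L c)).sum ≤
      (L.map fun c => φ (clauseType ℓ L c)).sum + ℓ * ∑ τ ∈ clauseTypes ℓ, φ τ := by
  rw [sum_map_clauseType hℓ, sum_map_clauseType hℓ, Finset.mul_sum, Finset.mul_sum,
    ← Finset.sum_add_distrib]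
  refine Finset.sum_le_sum fun τ _ => ?_
  have := Nat.mul_le_mul_left (φ τ) (mul_countP_block_le hℓ (L := L) τ i)
  linarith

theorem mul_length_block_le (i : ℕ) : ℓ * (block ℓ L i).length ≤
    L.length + ℓ * ((ℓ + 1) * ((ℓ + 1) * (ℓ + 1))) := by
  have := mul_sum_block_le hℓ (L := L) (fun _ => 1) i
  simpa [card_clauseTypes] using this

/-- How often `t` occurs in `τ`. -/
def typeCount (t : ℕ) (τ : ℕ × ℕ × ℕ) : ℕ :=
  (if τ.1 = t then 1 else 0) + ((if τ.2.1 = t then 1 else 0) + if τ.2.2 = t then 1 else 0)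

omit hℓ in
theorem sum_typeCount (t : ℕ) (l : List RawClause) :
    (l.map fun c => typeCount t (clauseType ℓ L c)).sum =
      (occs l).countP fun x => groupOf ℓ L x == t := by
  induction l with
  | nil => rfl
  | cons c l ih =>
    have h : occs (c :: l) = ((lits c).map fun l => l.1) ++ occs l := by simp [occs]
    rw [List.map_cons, List.sum_cons, ih, h, List.countP_append]
    congr 1
    by_cases h1 : groupOf ℓ L c.1.1 = t <;> by_cases h2 : groupOf ℓ L c.2.1.1 = t <;>
      by_cases h3 : groupOf ℓ L c.2.2.1 = t <;>
        simp [typeCount, clauseType, lits, h1, h2, h3]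

/-- The load of a single edge: a light group has at most `groupWidth` occurrences altogether, and
each block receives about a fraction 1/ℓ of them. -/
theorem mul_sum_typeCount_block_le {t : ℕ} (ht : t < ℓ) (i : ℕ) :
    ℓ * ((block ℓ L i).map fun c => typeCount t (clauseType ℓ L c)).sum ≤
      groupWidth ℓ L + ℓ * (3 * ((ℓ + 1) * ((ℓ + 1) * (ℓ + 1)))) := by
  refine (mul_sum_block_le hℓ _ i).trans (add_le_add ?_ (Nat.mul_le_mul_left _ ?_))
  · rw [sum_typeCount]
    exact countP_groupOf_le hℓ ht
  · rw [← card_clauseTypes, mul_comm, ← smul_eq_mul]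
    refine Finset.sum_le_card_nsmul _ _ _ fun τ _ => ?_
    unfold typeCount
    split_ifs <;> omega

theorem sum_sum_block (f : RawClause → ℕ) :
    ∑ i ∈ Finset.range ℓ, ((block ℓ L i).map f).sum = (L.map f).sum := by
  have key (D : List (RawClause × ℕ)) (hD : ∀ p ∈ D, p.2 < ℓ) :
      ∑ i ∈ Finset.range ℓ, (((D.filter fun p => p.2 == i).map fun p => p.1).map f).sum =
        ((D.map fun p => p.1).map f).sum := by
    induction D with
    | nil => simp
    | cons p D ih =>
      have h1 := ih fun q hq => hD q (by simp [hq])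
      have h2 := hD p (by simp)
      have h3 (i : ℕ) : ((((p :: D).filter fun p => p.2 == i).map fun p => p.1).map f).sum =
          (if p.2 = i then f p.1 else 0) +
            (((D.filter fun p => p.2 == i).map fun p => p.1).map f).sum := by
        by_cases h : p.2 = i <;> simp [h]
      simp only [h3, Finset.sum_add_distrib, h1, Finset.sum_ite_eq, Finset.mem_range, h2, if_true,
        List.map_cons, List.sum_cons]
  have := key (dealOut ℓ L L) fun p hp => snd_lt_of_mem_dealOut hℓ hp
  rwa [map_fst_dealOut] at this

/-! ### Sizes -/

/-- A block has at most m/ℓ + (ℓ+1)³ clauses with three occurrences each. A group has at most 3⌊m/ℓ⌋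
+ 4 light occurrences and at most ℓ heavy variables, which fits under the same bound. -/
theorem length_vars_le_strLen {n : ℕ} {U : Vert} (hU : U ∈ verts ℓ n L) :
    U.2.2.length ≤ strLen ℓ L.length := by
  rw [verts, List.mem_append, List.mem_map, List.mem_map] at hU
  unfold strLen
  rcases hU with ⟨i, -, rfl⟩ | ⟨t, ht, rfl⟩
  · have h1 := mul_length_block_le hℓ (L := L) i
    have h2 : (block ℓ L i).length ≤
        (L.length + ℓ * ((ℓ + 1) * ((ℓ + 1) * (ℓ + 1)))) / ℓ :=
      (Nat.le_div_iff_mul_le hℓ).2 (by rwa [mul_comm])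
    rw [Nat.add_mul_div_left _ _ hℓ] at h2
    change (occs (block ℓ L i)).length ≤ _
    rw [length_occs]
    exact Nat.mul_le_mul_left _ h2
  · change (groupVars ℓ n L t).length ≤ _
    rw [groupVars, List.length_append, ← List.countP_eq_length_filter]
    have h1 := countP_groupOf_le hℓ (L := L) (List.mem_range.1 ht)
    have h2 := length_filter_groupOf_eq hℓ (L := L) n
    have h3 : groupWidth ℓ L ≤ 3 * (L.length / ℓ) + 4 := by
      rw [groupWidth, length_occs]
      have h4 := Nat.lt_mul_div_succ L.length hℓ
      have : 3 * L.length / ℓ < 3 * (L.length / ℓ + 1) :=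
        Nat.div_lt_of_lt_mul (by linarith)
      omega
    have h4 : ℓ + 1 ≤ (ℓ + 1) * ((ℓ + 1) * (ℓ + 1)) := Nat.le_mul_of_pos_right _ (by positivity)
    omega

/-! ### Soundness -/

omit hℓ in
theorem mem_occs {l : List RawClause} {x : ℕ} :
    x ∈ occs l ↔ ∃ c ∈ l, ∃ b, (x, b) ∈ lits c := by
  simp [occs]

omit hℓ in
theorem countP_not_rawTrue (v : ℕ → Bool) (l : List RawClause) :
    l.countP (fun c => !rawTrue v c) = (l.map fun c => if rawTrue v c = true then 0 else 1).sum := by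
  induction l with
  | nil => rfl
  | cons c l ih =>
    rw [List.countP_cons, List.map_cons, List.sum_cons, ih]
    cases rawTrue v c <;> simp [add_comm]

/-- If few constraints between blocks and groups are violated, then some assignment violates few
clauses. -/
theorem exists_few_violated {n : ℕ} (hn : ∀ x ∈ occs L, x < n) (hm : manyClauses ℓ ≤ L.length)
    (a b : ℕ → List Bool) : ∃ v : ℕ → Bool,
      ℓ * ℓ * L.countP (fun c => !rawTrue v c) ≤ 7 * L.length *
        ((Finset.range ℓ ×ˢ Finset.range ℓ).filter fun p =>
          ¬ rel (blockVert ℓ L p.1) (groupVert ℓ n L p.2) (a p.1) (b p.2) = true).card := by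
  set bad : ℕ → ℕ → ℕ := fun i t =>
    if rel (blockVert ℓ L i) (groupVert ℓ n L t) (a i) (b t) = true then 0 else 1 with hbad
  have hcard : ((Finset.range ℓ ×ˢ Finset.range ℓ).filter fun p =>
      ¬ rel (blockVert ℓ L p.1) (groupVert ℓ n L p.2) (a p.1) (b p.2) = true).card =
      ∑ i ∈ Finset.range ℓ, ∑ t ∈ Finset.range ℓ, bad i t := by
    rw [Finset.card_filter, Finset.sum_product]
    simp only [hbad, ite_not]
  rw [hcard]
  set B := ∑ i ∈ Finset.range ℓ, ∑ t ∈ Finset.range ℓ, bad i t with hB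
  -- By averaging, some group r has at most B/ℓ violated edges.
  obtain ⟨r, hr, hrB⟩ : ∃ r ∈ Finset.range ℓ, ℓ * ∑ i ∈ Finset.range ℓ, bad i r ≤ B := by
    by_contra! h
    have h1 := Finset.sum_lt_sum_of_nonempty (Finset.nonempty_range_iff.2 hℓ.ne') h
    rw [Finset.sum_const, Finset.card_range, smul_eq_mul, ← Finset.mul_sum, Finset.sum_comm] at h1
    exact lt_irrefl _ h1
  -- Light variables are read at their own group. Heavy ones are stored at every group vertex, and
  -- all of them are read at r.
  set tgt : ℕ → ℕ := fun x => if groupOf ℓ L x = ℓ then r else groupOf ℓ L x with htgt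
  refine ⟨fun x => look (groupVars ℓ n L (tgt x)) (b (tgt x)) x, ?_⟩
  set v : ℕ → Bool := fun x => look (groupVars ℓ n L (tgt x)) (b (tgt x)) x with hv
  have hstored {x : ℕ} (hx : x ∈ occs L) : x ∈ groupVars ℓ n L (tgt x) := by
    rw [groupVars, List.mem_append, List.mem_filter, List.mem_filter]
    by_cases h : groupOf ℓ L x = ℓ
    · exact Or.inr ⟨List.mem_range.2 (hn x hx), by simpa using h⟩
    · exact Or.inl ⟨hx, by simp [htgt, h]⟩
  have hblock {i : ℕ} {c : RawClause} (hc : c ∈ block ℓ L i) : c ∈ L := by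
    rw [block, List.mem_map] at hc
    obtain ⟨p, hp, rfl⟩ := hc
    exact (mem_dealOut (List.mem_filter.1 hp).1).1
  -- If the edges from block i to the targets of all variables of c were satisfied, the letter at
  -- the block would satisfy c, and on the variable of a true literal it would agree with v.
  have hviol {i : ℕ} {c : RawClause} (hc : c ∈ block ℓ L i) (hcv : rawTrue v c = false) :
      ∃ l ∈ lits c, bad i (tgt l.1) = 1 := by
    by_contra! h
    have hgood {l : ℕ × Bool} (hl : l ∈ lits c) : rel (blockVert ℓ L i)
        (groupVert ℓ n L (tgt l.1)) (a i) (b (tgt l.1)) = true := by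
      by_contra h'
      exact h l hl (if_neg h')
    have hok : rawTrue (look (occs (block ℓ L i)) (a i)) c = true := by
      have h1 := hgood (l := c.1) (by simp [lits])
      simp only [rel, Bool.and_eq_true] at h1
      exact List.all_eq_true.1 h1.1.1 c hc
    rw [rawTrue, List.any_eq_true] at hok
    obtain ⟨l, hl, hl'⟩ := hok
    have h2 := hgood hl
    simp only [rel, Bool.and_eq_true] at h2
    have h3 := agree_iff.1 h2.2 l.1 (mem_occs.2 ⟨c, hc, l.2, hl⟩)
      (hstored (mem_occs.2 ⟨c, hblock hc, l.2, hl⟩))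
    have h4 : rawTrue v c = true := by
      rw [rawTrue, List.any_eq_true]
      exact ⟨l, hl, (congrArg (· == l.2) h3).symm.trans hl'⟩
    rw [h4] at hcv
    exact Bool.noConfusion hcv
  -- A violated clause is charged to a violated edge found above: a light literal is counted by
  -- `typeCount`, a heavy one by the last term. The factor 3 there is generous, since one unit per
  -- clause would do.
  have hclause {i : ℕ} {c : RawClause} (hc : c ∈ block ℓ L i) :
      (if rawTrue v c = true then 0 else 1) ≤
        ∑ t ∈ Finset.range ℓ, bad i t * typeCount t (clauseType ℓ L c) + bad i r * 3 := by
    split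
    · exact Nat.zero_le _
    rename_i hcv
    obtain ⟨l, hl, hlb⟩ := hviol hc (by simpa using hcv)
    by_cases hg : groupOf ℓ L l.1 = ℓ
    · rw [htgt] at hlb
      simp only [hg, if_true] at hlb
      omega
    · have hlt : groupOf ℓ L l.1 < ℓ := lt_of_le_of_ne (groupOf_le hℓ _) hg
      simp only [htgt, hg, if_false] at hlb
      have h1 : 1 ≤ typeCount (groupOf ℓ L l.1) (clauseType ℓ L c) := by
        simp only [lits, List.mem_cons, List.not_mem_nil, or_false] at hl
        unfold typeCount clauseType
        rcases hl with rfl | rfl | rfl <;> simp only [if_true] <;> omega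
      have h2 := Finset.single_le_sum
        (f := fun t => bad i t * typeCount t (clauseType ℓ L c)) (fun _ _ => Nat.zero_le _)
        (Finset.mem_range.2 hlt)
      simp only [hlb, one_mul] at h2
      omega
  set K := (ℓ + 1) * ((ℓ + 1) * (ℓ + 1)) with hK
  have hsum (i : ℕ) : ℓ * ((block ℓ L i).map fun c => if rawTrue v c = true then 0 else 1).sum ≤
      (∑ t ∈ Finset.range ℓ, bad i t) * (groupWidth ℓ L + ℓ * (3 * K)) +
        bad i r * (3 * (L.length + ℓ * K)) := by
    have h1 := List.sum_le_sum (l := block ℓ L i) (fun c hc => hclause hc)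
    have h2 : ((block ℓ L i).map fun c => ∑ t ∈ Finset.range ℓ,
        bad i t * typeCount t (clauseType ℓ L c) + bad i r * 3).sum =
        ∑ t ∈ Finset.range ℓ, bad i t *
          ((block ℓ L i).map fun c => typeCount t (clauseType ℓ L c)).sum +
          bad i r * (3 * (block ℓ L i).length) := by
      induction block ℓ L i with
      | nil => simp
      | cons c l ih =>
        simp only [List.map_cons, List.sum_cons, List.length_cons, ih, mul_add,
          Finset.sum_add_distrib]
        ring
    rw [h2] at h1
    refine (Nat.mul_le_mul_left ℓ h1).trans ?_
    rw [mul_add, Finset.mul_sum, Finset.sum_mul]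
    refine add_le_add (Finset.sum_le_sum fun t ht => ?_) ?_
    · have := Nat.mul_le_mul_left (bad i t)
        (mul_sum_typeCount_block_le hℓ (L := L) (Finset.mem_range.1 ht) i)
      rw [← hK] at this
      linarith
    · have := Nat.mul_le_mul_left (bad i r) (mul_length_block_le hℓ (L := L) i)
      rw [← hK] at this
      linarith
  have hcount : L.countP (fun c => !rawTrue v c) =
      ∑ i ∈ Finset.range ℓ,
        ((block ℓ L i).map fun c => if rawTrue v c = true then 0 else 1).sum := by
    rw [sum_sum_block hℓ]
    exact countP_not_rawTrue v L
  have htotal : ℓ * L.countP (fun c => !rawTrue v c) ≤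
      B * (groupWidth ℓ L + ℓ * (3 * K)) +
        (∑ i ∈ Finset.range ℓ, bad i r) * (3 * (L.length + ℓ * K)) := by
    rw [hcount, Finset.mul_sum, hB, Finset.sum_mul, Finset.sum_mul, ← Finset.sum_add_distrib]
    exact Finset.sum_le_sum fun i _ => hsum i
  have hwidth : ℓ * groupWidth ℓ L ≤ 3 * L.length + ℓ := by
    rw [groupWidth, length_occs, mul_add, mul_one]
    exact Nat.add_le_add_right (Nat.mul_div_le _ _) _
  -- These are all the rounding terms: from the interval width, from the edge loads, and from the
  -- block lengths. Being at most m, they contribute the last unit in 7 = 3 + 3 + 1.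
  have hmany : ℓ + ℓ * ℓ * (3 * K) + 3 * (ℓ * K) ≤ manyClauses ℓ := by
    rw [hK, manyClauses]
    nlinarith [Nat.zero_le ℓ, Nat.zero_le (ℓ ^ 2), Nat.zero_le (ℓ ^ 3), Nat.zero_le (ℓ ^ 4),
      Nat.zero_le (ℓ ^ 5)]
  calc ℓ * ℓ * L.countP (fun c => !rawTrue v c)
      = ℓ * (ℓ * L.countP fun c => !rawTrue v c) := by ring
    _ ≤ ℓ * (B * (groupWidth ℓ L + ℓ * (3 * K)) +
        (∑ i ∈ Finset.range ℓ, bad i r) * (3 * (L.length + ℓ * K))) :=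
        Nat.mul_le_mul_left _ htotal
    _ = B * (ℓ * groupWidth ℓ L + ℓ * ℓ * (3 * K)) +
        (ℓ * ∑ i ∈ Finset.range ℓ, bad i r) * (3 * (L.length + ℓ * K)) := by ring
    _ ≤ B * (3 * L.length + ℓ + ℓ * ℓ * (3 * K)) + B * (3 * (L.length + ℓ * K)) := by gcongr
    _ = B * (6 * L.length + (ℓ + ℓ * ℓ * (3 * K) + 3 * (ℓ * K))) := by ring
    _ ≤ B * (6 * L.length + L.length) := by gcongr; exact hmany.trans hm
    _ = 7 * L.length * B := by ring

end

/-! ### Completeness -/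

/-- The list may repeat a variable and later entries overwrite earlier ones, but every entry carries
the value of v. The invariant is that x is still to come or the stored value is already right. -/
theorem look_map (V : List ℕ) (v : ℕ → Bool) (r : List Bool) {x : ℕ} (hx : x ∈ V) :
    look V (V.map v ++ r) x = v x := by
  have key (V : List ℕ) (c : Bool) (hc : x ∈ V ∨ c = v x) :
      (V.foldl (fun (st : List Bool × Bool) y => (st.1.tail,
        if (y == x) = true then st.1.headD false else st.2)) (V.map v ++ r, c)).2 = v x := by
    induction V generalizing c with
    | nil => simpa using hc
    | cons y V ih =>
      rw [List.foldl_cons]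
      refine ih _ ?_
      by_cases h : y = x
      · right; simp [h]
      · rcases hc with hc | hc
        · left; simpa [Ne.symm h] using hc
        · right; simp [h, hc]
  exact key V false (Or.inl hx)

/-- Restrictions of one satisfying assignment agree everywhere; the tails r and r' are the padding
to the common length of the letters. -/
theorem rel_of_rawTrue {v : ℕ → Bool} {U W : Vert} (r r' : List Bool)
    (hU : ∀ c ∈ U.2.1, rawTrue v c = true ∧ ∀ l ∈ lits c, l.1 ∈ U.2.2)
    (hW : ∀ c ∈ W.2.1, rawTrue v c = true ∧ ∀ l ∈ lits c, l.1 ∈ W.2.2) :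
    rel U W (U.2.2.map v ++ r) (W.2.2.map v ++ r') = true := by
  have hok {U : Vert} (r : List Bool)
      (hU : ∀ c ∈ U.2.1, rawTrue v c = true ∧ ∀ l ∈ lits c, l.1 ∈ U.2.2) :
      vertOk U (U.2.2.map v ++ r) = true := by
    refine List.all_eq_true.2 fun c hc => ?_
    obtain ⟨h1, h2⟩ := hU c hc
    rw [rawTrue, List.any_eq_true] at h1 ⊢
    obtain ⟨l, hl, hl'⟩ := h1
    exact ⟨l, hl, by rwa [look_map _ _ _ (h2 l hl)]⟩
  simp only [rel, Bool.and_eq_true]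
  refine ⟨⟨hok r hU, hok r' hW⟩, agree_iff.2 fun x hx hx' => ?_⟩
  rw [look_map _ _ _ hx, look_map _ _ _ hx']

theorem rawTrue_of_mem_verts {ℓ n : ℕ} {L : List RawClause} {v : ℕ → Bool}
    (hv : ∀ c ∈ L, rawTrue v c = true) {U : Vert} (hU : U ∈ verts ℓ n L) :
    ∀ c ∈ U.2.1, rawTrue v c = true ∧ ∀ l ∈ lits c, l.1 ∈ U.2.2 := by
  rw [verts, List.mem_append, List.mem_map, List.mem_map] at hU
  rcases hU with ⟨i, -, rfl⟩ | ⟨t, -, rfl⟩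
  · intro c hc
    refine ⟨?_, fun l hl => mem_occs.2 ⟨c, hc, l.2, hl⟩⟩
    change c ∈ block ℓ L i at hc
    rw [block, List.mem_map] at hc
    obtain ⟨p, hp, rfl⟩ := hc
    exact hv _ (mem_dealOut (List.mem_filter.1 hp).1).1
  · intro c hc
    exact absurd hc List.not_mem_nil

/-! ### Values -/

theorem CNF3.exists_satFrac_eq_sat (F : CNF3) : ∃ a, F.satFrac a = F.sat :=
  exists_eq_ciSup_of_finite

theorem CNF3.satFrac_le_sat (F : CNF3) (a : Fin F.numVars → Bool) : F.satFrac a ≤ F.sat :=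
  le_ciSup (Set.finite_range F.satFrac).bddAbove a

theorem TwoCSP.exists_assignVal_eq_val (I : TwoCSP) : ∃ ψ, I.assignVal ψ = I.val := by
  have : Nonempty (Fin I.alphSize) := ⟨⟨0, I.alphSize_pos⟩⟩
  exact exists_eq_ciSup_of_finite

theorem TwoCSP.assignVal_le_val (I : TwoCSP) (ψ : Fin I.numVars → Fin I.alphSize) :
    I.assignVal ψ ≤ I.val :=
  le_ciSup (Set.finite_range I.assignVal).bddAbove ψ

theorem TwoCSP.assignVal_le_one (I : TwoCSP) (ψ : Fin I.numVars → Fin I.alphSize) :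
    I.assignVal ψ ≤ 1 := by
  unfold assignVal
  split
  · exact le_rfl
  · exact div_le_one_of_le₀ (Nat.cast_le.2 (Set.ncard_le_ncard (Set.sep_subset _ _)))
      (Nat.cast_nonneg _)

theorem TwoCSP.val_eq_one (I : TwoCSP) (ψ : Fin I.numVars → Fin I.alphSize)
    (h : ∀ u v, I.con u v (ψ u) (ψ v) = true) : I.val = 1 := by
  refine le_antisymm ?_ ?_
  · obtain ⟨ψ', hψ'⟩ := I.exists_assignVal_eq_val
    exact hψ' ▸ I.assignVal_le_one ψ'
  · refine le_trans (le_of_eq ?_) (I.assignVal_le_val ψ)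
    unfold assignVal
    split
    · rfl
    · rename_i h0
      rw [Set.sep_eq_self_iff_mem_true.2 fun e _ u v _ => h u v, div_self (Nat.cast_ne_zero.2 h0)]

/-- The number of violated edges, from the value of an assignment. -/
theorem TwoCSP.ncard_violated_le (I : TwoCSP) (ψ : Fin I.numVars → Fin I.alphSize) {ε : ℝ}
    (h : 1 - ε ≤ I.assignVal ψ) :
    ({e ∈ I.graph.edgeSet | ¬ I.EdgeSat ψ e}.ncard : ℝ) ≤ ε * I.graph.edgeSet.ncard := by
  have hsum : {e ∈ I.graph.edgeSet | I.EdgeSat ψ e}.ncard +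
      {e ∈ I.graph.edgeSet | ¬ I.EdgeSat ψ e}.ncard = I.graph.edgeSet.ncard := by
    rw [← Set.ncard_union_eq]
    · congr 1
      ext e
      simp only [Set.mem_union, Set.mem_sep_iff]
      tauto
    · rw [Set.disjoint_left]
      exact fun e h1 h2 => h2.2 h1.2
  have hsum' := congrArg (Nat.cast (R := ℝ)) hsum
  push_cast at hsum'
  unfold assignVal at h
  split at h
  · rename_i h0
    rw [h0] at hsum' ⊢
    have h1 : (0 : ℝ) ≤ ({e ∈ I.graph.edgeSet | I.EdgeSat ψ e}.ncard : ℝ) := Nat.cast_nonneg _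
    push_cast at hsum' ⊢
    linarith
  · rename_i h0
    have hpos : (0 : ℝ) < I.graph.edgeSet.ncard := Nat.cast_pos.2 (Nat.pos_of_ne_zero h0)
    rw [le_div_iff₀ hpos] at h
    linarith

/-! ### The instance of the reduction -/

theorem verts_fst {ℓ n : ℕ} {L : List RawClause} (u : Fin (verts ℓ n L).length) :
    ((verts ℓ n L).get u).1 = decide ((u : ℕ) < ℓ) := by
  rw [List.get_eq_getElem]
  by_cases h : (u : ℕ) < ℓ
  · simp only [verts]
    rw [List.getElem_append_left (by simpa using h)]
    simp [blockVert, h]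
  · simp only [verts]
    rw [List.getElem_append_right (by simpa using h)]
    simp [groupVert, h]

theorem verts_get_block {ℓ n : ℕ} {L : List RawClause} (u : Fin (verts ℓ n L).length)
    (h : (u : ℕ) < ℓ) : (verts ℓ n L).get u = blockVert ℓ L u := by
  rw [List.get_eq_getElem]
  simp only [verts]
  rw [List.getElem_append_left (by simpa using h)]
  simp

theorem verts_get_group {ℓ n : ℕ} {L : List RawClause} (u : Fin (verts ℓ n L).length) {t : ℕ}
    (h : (u : ℕ) = ℓ + t) : (verts ℓ n L).get u = groupVert ℓ n L t := by
  rw [List.get_eq_getElem]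
  simp only [verts]
  rw [List.getElem_append_right (by simp; omega)]
  simp [h]

theorem mkCSP_val_eq_one {ℓ n : ℕ} (hℓ : 0 < ℓ) {L : List RawClause} {v : ℕ → Bool}
    (hv : ∀ c ∈ L, rawTrue v c = true) (hS : 0 < (strings (strLen ℓ L.length)).length) :
    (mkCSP (verts ℓ n L) (strings (strLen ℓ L.length)) hS).val = 1 := by
  have hex (u : Fin (verts ℓ n L).length) : ∃ i, (strings (strLen ℓ L.length)).get i =
      ((verts ℓ n L).get u).2.2.map v ++ List.replicate
        (strLen ℓ L.length - ((verts ℓ n L).get u).2.2.length) false := by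
    rw [← List.mem_iff_get, mem_strings]
    have := length_vars_le_strLen hℓ (List.get_mem (verts ℓ n L) u)
    rw [List.length_append, List.length_map, List.length_replicate]
    omega
  choose ψ hψ using hex
  have hrel (u v : Fin (verts ℓ n L).length) : rel ((verts ℓ n L).get u) ((verts ℓ n L).get v)
      ((strings _).get (ψ u)) ((strings _).get (ψ v)) = true := by
    rw [hψ, hψ]
    exact rel_of_rawTrue _ _ (rawTrue_of_mem_verts hv (List.get_mem _ _))
      (rawTrue_of_mem_verts hv (List.get_mem _ _))
  exact TwoCSP.val_eq_one _ ψ hrel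

/-- This translates between fractions of edges and pairs (i, t): block i is vertex i, group t is
vertex ℓ + t. -/
theorem exists_few_violated_of_le_val {ℓ n : ℕ} (hℓ : 0 < ℓ) {L : List RawClause}
    (hn : ∀ x ∈ occs L, x < n) (hm : manyClauses ℓ ≤ L.length) {S : List (List Bool)}
    (hS : 0 < S.length) {ε : ℝ} (hε : 0 ≤ ε) (h : 1 - ε ≤ (mkCSP (verts ℓ n L) S hS).val) :
    ∃ v : ℕ → Bool, (L.countP (fun c => !rawTrue v c) : ℝ) ≤ 7 * ε * L.length := by
  set I := mkCSP (verts ℓ n L) S hS with hI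
  obtain ⟨ψ, hψ⟩ := I.exists_assignVal_eq_val
  have hviol := I.ncard_violated_le ψ (hψ ▸ h)
  have hlen : I.numVars = 2 * ℓ := length_verts ℓ n L
  have hlt {p : ℕ × ℕ} (hp : p ∈ Finset.range ℓ ×ˢ Finset.range ℓ) :
      p.1 < I.numVars ∧ ℓ + p.2 < I.numVars := by
    rw [Finset.mem_product, Finset.mem_range, Finset.mem_range] at hp
    omega
  let y (i : ℕ) : Fin I.numVars := if h : i < I.numVars then ⟨i, h⟩ else ⟨0, by omega⟩
  have hy {i : ℕ} (h : i < I.numVars) : (y i : ℕ) = i := by simp [y, h]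
  let f (p : ℕ × ℕ) : Sym2 (Fin I.numVars) := s(y p.1, y (ℓ + p.2))
  have hadj (u v : Fin I.numVars) : I.graph.Adj u v ↔ ¬((u : ℕ) < ℓ ↔ (v : ℕ) < ℓ) := by
    have h (u v : Fin (verts ℓ n L).length) : ((verts ℓ n L).get u).1 ≠
        ((verts ℓ n L).get v).1 ↔ ¬((u : ℕ) < ℓ ↔ (v : ℕ) < ℓ) := by
      rw [verts_fst, verts_fst, ne_eq, decide_eq_decide]
    exact h u v
  -- Only an upper bound on the number of edges is needed, since it turns a small fraction of
  -- violated edges into a small number.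
  have hedges : I.graph.edgeSet.ncard ≤ ℓ * ℓ := by
    have hsub : I.graph.edgeSet ⊆ f '' (Finset.range ℓ ×ˢ Finset.range ℓ : Finset (ℕ × ℕ)) := by
      have hmem {u v : Fin I.numVars} (hu : (u : ℕ) < ℓ) (hv : ¬(v : ℕ) < ℓ) :
          s(u, v) ∈ f '' (Finset.range ℓ ×ˢ Finset.range ℓ : Finset (ℕ × ℕ)) := by
        refine ⟨((u : ℕ), (v : ℕ) - ℓ), ?_, ?_⟩
        · simp only [Finset.coe_product, Finset.coe_range, Set.mem_prod, Set.mem_Iio]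
          omega
        · have h1 : y u = u := Fin.ext (hy u.2)
          have h2 : y (ℓ + (v - ℓ)) = v := Fin.ext (by rw [hy (by omega)]; omega)
          simp only [f, h1, h2]
      intro e
      induction e using Sym2.ind with
      | _ u v =>
        rw [SimpleGraph.mem_edgeSet, hadj]
        intro huv
        by_cases hu : (u : ℕ) < ℓ
        · exact hmem hu (by tauto)
        · rw [Sym2.eq_swap]
          exact hmem (by tauto) hu
    refine (Set.ncard_le_ncard hsub (Set.toFinite _)).trans
      ((Set.ncard_image_le (Finset.finite_toSet _)).trans ?_)
    rw [Set.ncard_coe_finset, Finset.card_product, Finset.card_range]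
  obtain ⟨v, hv⟩ := exists_few_violated hℓ hn hm (fun i => S.get (ψ (y i)))
    (fun t => S.get (ψ (y (ℓ + t))))
  set B := (Finset.range ℓ ×ˢ Finset.range ℓ).filter fun p => ¬ rel (blockVert ℓ L p.1)
    (groupVert ℓ n L p.2) (S.get (ψ (y p.1))) (S.get (ψ (y (ℓ + p.2)))) = true with hB
  -- Distinct pairs give distinct edges because the two sides occupy disjoint ranges of vertices.
  have hbad : B.card ≤ {e ∈ I.graph.edgeSet | ¬ I.EdgeSat ψ e}.ncard := by
    rw [Set.ncard_eq_toFinset_card _ (Set.toFinite _)]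
    refine Finset.card_le_card_of_injOn f (fun p hp => ?_) fun p hp q hq hpq => ?_
    · rw [Finset.mem_coe, hB, Finset.mem_filter] at hp
      have h1 := hlt hp.1
      have h2 := hp.1
      rw [Finset.mem_product, Finset.mem_range, Finset.mem_range] at h2
      rw [Finset.mem_coe, Set.Finite.mem_toFinset, Set.mem_sep_iff, SimpleGraph.mem_edgeSet, hadj,
        hy h1.1, hy h1.2]
      refine ⟨by omega, fun hsat => hp.2 ?_⟩
      have h3 (u v : Fin (verts ℓ n L).length) (a b : List Bool) (hu : (u : ℕ) = p.1)
          (hv : (v : ℕ) = ℓ + p.2) : rel ((verts ℓ n L).get u) ((verts ℓ n L).get v) a b =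
            rel (blockVert ℓ L p.1) (groupVert ℓ n L p.2) a b := by
        rw [verts_get_block u (hu ▸ h2.1), verts_get_group v hv, hu]
      exact (h3 _ _ _ _ (hy h1.1) (hy h1.2)).symm.trans (hsat _ _ rfl)
    · rw [Finset.mem_coe, hB, Finset.mem_filter] at hp hq
      have h1 := hlt hp.1
      have h2 := hlt hq.1
      have h3 := hp.1
      have h4 := hq.1
      rw [Finset.mem_product, Finset.mem_range, Finset.mem_range] at h3 h4
      simp only [f, Sym2.eq_iff, Fin.ext_iff, hy h1.1, hy h1.2, hy h2.1, hy h2.2] at hpq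
      exact Prod.ext (by omega) (by omega)
  refine ⟨v, ?_⟩
  have hv' : ((ℓ * ℓ * L.countP (fun c => !rawTrue v c) : ℕ) : ℝ) ≤
    ((7 * L.length * B.card : ℕ) : ℝ) := Nat.cast_le.2 hv
  have hbad' : (B.card : ℝ) ≤ ε * (ℓ * ℓ) := by
    refine (Nat.cast_le.2 hbad).trans (hviol.trans ?_)
    gcongr
    exact_mod_cast hedges
  push_cast at hv'
  have hℓ' : (0 : ℝ) < ℓ * ℓ := by positivity
  refine le_of_mul_le_mul_left ?_ hℓ'
  calc _ ≤ 7 * (L.length : ℝ) * B.card := hv'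
    _ ≤ 7 * (L.length : ℝ) * (ε * (ℓ * ℓ)) := by gcongr
    _ = _ := by ring

/-! ### Formulas -/

/-- The clauses of a formula, as the parser returns them. -/
def rawClauses (F : CNF3) : List RawClause := F.clauses.map toRaw

theorem countP_rawTrue (F : CNF3) (v : ℕ → Bool) :
    (rawClauses F).countP (rawTrue v) =
      F.clauses.countP (CNF3.clauseTrue fun x => v x) := by
  rw [rawClauses, List.countP_map]
  refine List.countP_congr fun c _ => ?_
  simp [rawTrue, lits, toRaw, CNF3.clauseTrue, CNF3.litTrue, or_assoc]

theorem mem_inflate {ℓ : ℕ} {L : List RawClause} {c : RawClause} (h : c ∈ inflate ℓ L) :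
    c ∈ L := by
  unfold inflate at h
  split at h
  · simp only [List.mem_flatMap] at h
    exact h.choose_spec.2
  · exact h

/-- Repetition preserves the fraction of clauses with a property; the cross-multiplied form also
covers the empty list. -/
theorem countP_inflate (ℓ : ℕ) (L : List RawClause) (P : RawClause → Bool) :
    (inflate ℓ L).countP P * L.length = L.countP P * (inflate ℓ L).length := by
  unfold inflate
  split
  · simp [List.countP_flatMap, List.length_flatMap, Function.comp_def]
    ring
  · rfl

theorem manyClauses_le_length_inflate {ℓ : ℕ} {L : List RawClause} (hL : L ≠ []) :
    manyClauses ℓ ≤ (inflate ℓ L).length := by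
  have := List.length_pos_iff.2 hL
  unfold inflate
  split
  · simp [List.length_flatMap]
    exact Nat.le_mul_of_pos_right _ this
  · rename_i h
    simpa using h

theorem length_inflate_le (ℓ : ℕ) (L : List RawClause) :
    (inflate ℓ L).length ≤ L.length + manyClauses ℓ ^ 2 := by
  unfold inflate
  split
  · rename_i h
    simp only [decide_eq_true_eq] at h
    simp only [List.length_flatMap, List.map_const', List.sum_replicate, smul_eq_mul,
      List.length_range]
    nlinarith
  · exact Nat.le_add_right _ _

theorem workClauses_encode (ℓ : ℕ) (F : CNF3) :
    workClauses (ℓ, F.encode) = inflate ℓ (rawClauses F) := by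
  rw [workClauses, parse_encode, rawClauses]

/-- The instance of 2CSP constructed from a formula. -/
def reducedCSP (ℓ : ℕ) (F : CNF3) : TwoCSP :=
  mkCSP (verts ℓ F.encode.length (workClauses (ℓ, F.encode))) (strings (alphExp (ℓ, F.encode)))
    (by rw [length_strings]; positivity)

theorem reducedCSP_input (ℓ : ℕ) (F : CNF3) :
    (reducedCSP ℓ F).input = reduction (ℓ, F.encode) :=
  Prod.ext (encode_mkCSP _ _ _) (length_verts _ _ _)

theorem reducedCSP_val_eq_one {ℓ : ℕ} (hℓ : 0 < ℓ) {F : CNF3} (h : F.sat = 1) :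
    (reducedCSP ℓ F).val = 1 := by
  obtain ⟨a, ha⟩ := F.exists_satFrac_eq_sat
  rw [h] at ha
  have hall : ∀ c ∈ F.clauses, CNF3.clauseTrue a c = true := by
    rw [← List.countP_eq_length]
    unfold CNF3.satFrac at ha
    split at ha
    · rename_i h0
      rw [List.length_eq_zero_iff.1 h0]
      rfl
    · rename_i h0
      rw [div_eq_one_iff_eq (Nat.cast_ne_zero.2 h0)] at ha
      exact_mod_cast ha
  set v : ℕ → Bool := fun x => if hx : x < F.numVars then a ⟨x, hx⟩ else false with hv
  have hva : (fun x : Fin F.numVars => v x) = a := by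
    funext x
    simp [hv]
  have hraw : ∀ c ∈ rawClauses F, rawTrue v c = true := by
    rw [← List.countP_eq_length, countP_rawTrue, hva, List.countP_eq_length.2 hall, rawClauses,
      List.length_map]
  unfold reducedCSP alphExp
  refine mkCSP_val_eq_one hℓ (v := v) (fun c hc => ?_) _
  rw [workClauses_encode] at hc
  exact hraw c (mem_inflate hc)

/-- If the value were at least 1 - ε/8, some assignment would violate at most a fraction 7ε/8 ≤ ε of
the clauses, first of the repeated list and hence of the formula. -/
theorem reducedCSP_val_lt {ℓ : ℕ} (hℓ : 0 < ℓ) {F : CNF3} {ε : ℝ} (hε : 0 ≤ ε)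
    (h : F.sat < 1 - ε) : (reducedCSP ℓ F).val < 1 - ε / 8 := by
  have hne : F.clauses.length ≠ 0 := by
    intro h0
    have := F.satFrac_le_sat fun _ => false
    rw [CNF3.satFrac, if_pos h0] at this
    linarith
  by_contra! hval
  have hlen : (rawClauses F).length = F.clauses.length := List.length_map _
  have hne' : rawClauses F ≠ [] := by
    rw [← List.length_pos_iff, hlen]
    exact Nat.pos_of_ne_zero hne
  have hm := manyClauses_le_length_inflate (ℓ := ℓ) hne'
  rw [← workClauses_encode] at hm
  -- The length of the code bounds the number of variables because the code starts with that number
  -- in unary.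
  have hn : ∀ x ∈ occs (workClauses (ℓ, F.encode)), x < F.encode.length := by
    intro x hx
    obtain ⟨c, hc, b, hb⟩ := mem_occs.1 hx
    rw [workClauses_encode] at hc
    have hc' := mem_inflate hc
    rw [rawClauses, List.mem_map] at hc'
    obtain ⟨c, -, rfl⟩ := hc'
    have hx : x < F.numVars := by
      simp only [lits, toRaw, List.mem_cons, Prod.mk.injEq, List.not_mem_nil, or_false] at hb
      rcases hb with hb | hb | hb <;> rw [hb.1] <;> exact Fin.is_lt _
    simp only [CNF3.encode, unary, List.length_append, List.length_replicate]
    omega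
  obtain ⟨v, hv⟩ := exists_few_violated_of_le_val hℓ hn hm _ (by positivity) hval
  have hcount := countP_inflate ℓ (rawClauses F) fun c => !rawTrue v c
  rw [← workClauses_encode, hlen] at hcount
  have hnot : (rawClauses F).length = (rawClauses F).countP (rawTrue v) +
      (rawClauses F).countP fun c => !rawTrue v c := by
    rw [List.length_eq_countP_add_countP (rawTrue v)]
    congr 1
    exact List.countP_congr fun c _ => by simp
  rw [hlen, countP_rawTrue] at hnot
  have hsat := F.satFrac_le_sat fun x => v x
  rw [CNF3.satFrac, if_neg hne] at hsat
  have hpos : (0 : ℝ) < F.clauses.length := Nat.cast_pos.2 (Nat.pos_of_ne_zero hne)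
  have hwpos : (0 : ℝ) < (workClauses (ℓ, F.encode)).length := by
    refine Nat.cast_pos.2 (lt_of_lt_of_le ?_ hm)
    unfold manyClauses
    positivity
  rw [div_le_iff₀ hpos] at hsat
  have hcount' := congrArg (Nat.cast (R := ℝ)) hcount
  have hnot' := congrArg (Nat.cast (R := ℝ)) hnot
  push_cast at hcount' hnot'
  have hviol : ((rawClauses F).countP (fun c => !rawTrue v c) : ℝ) ≤
      7 * (ε / 8) * F.clauses.length := by
    refine le_of_mul_le_mul_right ?_ hwpos
    rw [← hcount']
    calc _ ≤ 7 * (ε / 8) * (workClauses (ℓ, F.encode)).length * F.clauses.length := by gcongr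
      _ = _ := by ring
  nlinarith [mul_nonneg hε hpos.le]

/-! ## Programs that start with a deterministic transformation of the input -/

/-- The initial store. -/
def inputStore (i : List Bool × ℕ) : Store := fun r => if r = 0 then Data.ofBits i.1
    else if r = 1 then Data.ofBits (List.replicate i.2 true) else Data.nil

theorem init_eq (p : Prog) (i : List Bool × ℕ) : init p i = ([p], inputStore i) := rfl

theorem runFor_seq {q p : Prog} {i j : List Bool × ℕ} {t : ℕ}
    (h : Exec q (inputStore i) (inputStore j) t) (t' : ℕ) :
    runFor (1 + t + t') (init (.seq q p) i) = runFor t' (init p j) := by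
  have h0 : runFor 1 (init (.seq q p) i) = PMF.pure ([q, p], inputStore i) := by
    simp only [init_eq, runFor, step, PMF.pure_bind]
  rw [runFor_add, runFor_add, h0, PMF.pure_bind, h, PMF.pure_bind, init_eq]

/-- The composed program reproduces every run of `p` with a fixed delay; this inequality already
transfers correctness with probability 2/3. -/
theorem prOut_le_prOut_seq {q p : Prog} {i j : List Bool × ℕ} {t : ℕ}
    (h : Exec q (inputStore i) (inputStore j) t) (b : Bool) :
    prOut p j b ≤ prOut (.seq q p) i b :=
  iSup_le fun t' => by
    rw [← runFor_seq h t']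
    exact le_iSup (fun t => (runFor t (init (.seq q p) i)).toOuterMeasure
      {c | c.1 = [] ∧ (c.2 0).truth = b}) _

theorem HaltsWithin.seq {q p : Prog} {i j : List Bool × ℕ} {t : ℕ} {B B' : ℝ}
    (h : Exec q (inputStore i) (inputStore j) t) (hp : HaltsWithin p j B)
    (hB : 1 + t + B ≤ B') : HaltsWithin (.seq q p) i B' := by
  obtain ⟨t', ht', hc⟩ := hp
  refine ⟨1 + t + t', ?_, ?_⟩
  · push_cast
    linarith
  · rwa [runFor_seq h]

theorem HaltsWithin.mono {p : Prog} {i : List Bool × ℕ} {B B' : ℝ} (h : HaltsWithin p i B)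
    (hB : B ≤ B') : HaltsWithin p i B' := by
  obtain ⟨t, ht, h⟩ := h
  exact ⟨t, ht.trans hB, h⟩

theorem enc_bits (l : List Bool) : enc l = Data.ofBits l := by
  induction l with
  | nil => rfl
  | cons b l ih => exact congrArg (Data.cons _) ih

/-- Move a pair from register `0` to the registers `0` and `1`, and clear the registers
`2, …, 6`. -/
def unpairProg : Prog :=
  .seq (.tl 1 0) <| .seq (.hd 0 0) <| .seq (.setNil 2) <| .seq (.setNil 3) <| .seq (.setNil 4) <|
    .seq (.setNil 5) (.setNil 6)

/-- The program that prepends the constant `d` to the input, runs `q`, and takes the result as an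
input. -/
def prepareProg (d : Data) (q : Prog) : Prog :=
  .seq (pairProg (constProg d) (.copy 0 0)) (.seq q unpairProg)

/-- The next program has to meet an exact initial store, so the scratch registers 2 to 6 are
cleared; the registers from 7 on were never touched. -/
theorem exec_prepareProg {d : Data} {q : Prog} {i j : List Bool × ℕ} {T : ℕ}
    (h : Transforms q (.cons d (enc i.1)) (enc j) T) :
    ∃ t ≤ 35 + 17 * d.size + T, Exec (prepareProg d q) (inputStore i) (inputStore j) t := by
  obtain ⟨t₁, ht₁, s₁, e₁, h0, -, h2⟩ :=
    (transforms_constProg d (enc i.1)).pair (transforms_id (enc i.1)) (inputStore i)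
      (enc_bits i.1).symm
  obtain ⟨t₂, ht₂, s₂, e₂, k0, -, k2⟩ := h s₁ h0
  have k0' : s₂ 0 = .cons (Data.ofBits j.1) (Data.ofBits (List.replicate j.2 true)) := by
    rw [k0, ← enc_bits, ← enc_bits]
    rfl
  have e₃ := Exec.seq (Exec.tl_of (x := 1) _ k0') <|
    Exec.seq (Exec.hd_of (x := 0) (y := 0) (Data.ofBits j.1)
      (w := Data.ofBits (List.replicate j.2 true)) (by simpa using k0')) <|
    Exec.seq (Exec.setNil 2 _) <| Exec.seq (Exec.setNil 3 _) <| Exec.seq (Exec.setNil 4 _) <|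
    Exec.seq (Exec.setNil 5 _) <| Exec.setNil 6 _
  refine ⟨1 + (t₁ + (1 + (t₂ + 13))), by omega, ?_⟩
  convert e₁.seq (e₂.seq e₃) using 1
  · rfl
  funext r
  by_cases hr : 7 ≤ r
  · have hn : r ≠ 0 ∧ r ≠ 1 ∧ r ≠ 2 ∧ r ≠ 3 ∧ r ≠ 4 ∧ r ≠ 5 ∧ r ≠ 6 := by omega
    simp [hn, k2 r hr, h2 r hr, inputStore]
  · obtain rfl | rfl | rfl | rfl | rfl | rfl | rfl :
      r = 0 ∨ r = 1 ∨ r = 2 ∨ r = 3 ∨ r = 4 ∨ r = 5 ∨ r = 6 := by omega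
    all_goals simp [inputStore]

/-! ## Growth rates -/

/-- A is the sum of the coefficients and d the degree. -/
theorem exists_eval_le (P : Polynomial ℕ) : ∃ A d : ℕ, ∀ n, 1 ≤ n → P.eval n ≤ A * n ^ d := by
  refine ⟨P.eval 1, P.natDegree, fun n hn => ?_⟩
  simp only [Polynomial.eval_eq_sum_range, one_pow, mul_one, Finset.sum_mul]
  refine Finset.sum_le_sum fun i hi => ?_
  gcongr
  exact Nat.lt_succ_iff.1 (Finset.mem_range.1 hi)

theorem exists_pow_le_rpow (d : ℕ) {η : ℝ} (hη : 0 < η) :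
    ∃ K : ℝ, 0 ≤ K ∧ ∀ n : ℕ, ((n : ℝ) + 1) ^ d ≤ K * (2 : ℝ) ^ (η * n) := by
  have hr : (1 : ℝ) < 2 ^ η := Real.one_lt_rpow (by norm_num) hη
  obtain ⟨K, hK⟩ := (tendsto_pow_const_div_const_pow_of_one_lt d hr).bddAbove_range
  have hK' (n : ℕ) : (n : ℝ) ^ d / ((2 : ℝ) ^ η) ^ n ≤ K := hK ⟨n, rfl⟩
  have hK0 : 0 ≤ K := le_trans (by positivity) (hK' 0)
  refine ⟨K * 2 ^ η, by positivity, fun n => ?_⟩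
  have := hK' (n + 1)
  rw [div_le_iff₀ (by positivity), pow_succ, ← Real.rpow_mul_natCast (by norm_num)] at this
  push_cast at this
  linarith

theorem length_encode_le (F : CNF3) :
    F.encode.length ≤ F.numVars + 2 + F.clauses.length * (3 * F.numVars + 4) := by
  have hlit (l : Literal F.numVars) : (CNF3.encodeLit l).length ≤ F.numVars + 1 := by
    have := l.1.2
    simp only [CNF3.encodeLit, unary, List.length_cons, List.length_append, List.length_replicate,
      List.length_nil]
    omega
  have hcl (l : List (Clause F.numVars)) :
      (CNF3.encodeClauses l).length ≤ 1 + l.length * (3 * F.numVars + 4) := by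
    induction l with
    | nil => simp [CNF3.encodeClauses]
    | cons c l ih =>
      have h1 := hlit c.1
      have h2 := hlit c.2.1
      have h3 := hlit c.2.2
      simp only [CNF3.encodeClauses, CNF3.encodeClause, List.length_cons, List.length_append,
        Nat.add_one_mul l.length]
      omega
  have := hcl F.clauses
  simp only [CNF3.encode, unary, List.length_append, List.length_replicate, List.length_cons,
    List.length_nil]
  omega

theorem sz_bits_le (l : List Bool) : sz l ≤ 4 * l.length + 1 := by
  have := sz_le_length_mul l fun b _ => sz_bool b
  omega

/-- The exponent of the size of the alphabet is at most `3 m / ℓ`, up to a constant depending on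
`ℓ`. -/
theorem alphExp_le (ℓ : ℕ) (F : CNF3) : (alphExp (ℓ, F.encode) : ℝ) ≤
    3 * F.clauses.length / ℓ + strLen ℓ (manyClauses ℓ ^ 2) + 3 := by
  have h1 := length_inflate_le ℓ (rawClauses F)
  rw [← workClauses_encode, rawClauses, List.length_map] at h1
  have h2 : (workClauses (ℓ, F.encode)).length / ℓ ≤
      F.clauses.length / ℓ + manyClauses ℓ ^ 2 / ℓ + 1 := by
    rcases Nat.eq_zero_or_pos ℓ with rfl | hℓ
    · simp
    refine (Nat.div_le_div_right h1).trans ?_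
    rw [Nat.add_div hℓ]
    split <;> omega
  have h3 : alphExp (ℓ, F.encode) ≤
      3 * (F.clauses.length / ℓ) + strLen ℓ (manyClauses ℓ ^ 2) + 3 := by
    unfold alphExp strLen
    dsimp only
    omega
  have h4 : ((F.clauses.length / ℓ : ℕ) : ℝ) ≤ F.clauses.length / ℓ := Nat.cast_div_le
  have h5 := (Nat.cast_le (α := ℝ)).2 h3
  push_cast at h5
  rw [mul_div_assoc]
  linarith

/-- Gap-ETH rules out algorithms for the gap version of 2CSP that have, for almost all `k`, running
time `2 ^ (o(n))` on the instances constructed with `k` vertices. -/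
theorem not_solves_gap2CSP {ε : ℝ≥0} {δ : ℝ} {C : ℕ} (hδ : 0 < δ)
    (hETH : ¬ ∃ p : Prog, Solves p (gap3SAT ε C) ∧
      ∃ K : ℝ, ∀ F : CNF3, F.clauses.length ≤ C * F.numVars →
        HaltsWithin p F.input (K * (2 : ℝ) ^ (δ * (F.numVars : ℝ))))
    (T : ℕ → ℝ) (g : ℕ → ℝ) (hg : g =o[Filter.atTop] (fun k : ℕ => (k : ℝ))) (p : Prog)
    (hp : Solves p (gap2CSP (ε / 8)))
    (hT : ∀ I : TwoCSP, HaltsWithin p I.input (T I.numVars * (I.alphSize : ℝ) ^ g I.numVars)) :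
    False := by
  obtain ⟨q, P, hq⟩ := polyTimeIn_reduction
  obtain ⟨A, d, hA⟩ := exists_eval_le P
  -- the choice of `ℓ`
  obtain ⟨ℓ, hℓ, hℓd, hℓg⟩ : ∃ ℓ : ℕ, 0 < ℓ ∧ 3 * C / (ℓ : ℝ) * d ≤ δ / 2 ∧
      |g (2 * ℓ)| * (3 * C / (ℓ : ℝ)) ≤ δ := by
    -- With |g(2ℓ)| at most this constant times 2ℓ, the product with 3C/ℓ is δ·6C/(6C+6) ≤ δ; the
    -- summand 6 keeps the denominator positive when C = 0.
    have h1 := hg.def (c := δ / (6 * C + 6)) (by positivity)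
    have h2 : Filter.Tendsto (fun ℓ : ℕ => 2 * ℓ) Filter.atTop Filter.atTop :=
      Filter.tendsto_id.const_mul_atTop' (by norm_num)
    have h3 := h2.eventually h1
    have h4 : Filter.Tendsto (fun ℓ : ℕ => 3 * C * d / (ℓ : ℝ)) Filter.atTop (nhds 0) :=
      tendsto_const_div_atTop_nhds_zero_nat _
    have h5 := h4.eventually (ge_mem_nhds (half_pos hδ))
    obtain ⟨ℓ, h6, h7, h8⟩ := (h3.and (h5.and (Filter.eventually_gt_atTop 0))).exists
    have hℓ : (0 : ℝ) < ℓ := Nat.cast_pos.2 h8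
    refine ⟨ℓ, h8, by rwa [div_mul_eq_mul_div], ?_⟩
    rw [Real.norm_eq_abs, Real.norm_natCast] at h6
    push_cast at h6
    calc _ ≤ δ / (6 * C + 6) * (2 * ℓ) * (3 * C / (ℓ : ℝ)) := by gcongr
      _ = δ * (6 * C / (6 * C + 6)) := by field_simp; ring
      _ ≤ δ * 1 := by
        gcongr
        rw [div_le_one (by positivity)]
        linarith
      _ = δ := mul_one δ
  refine hETH ⟨.seq (prepareProg (enc ℓ) q) p, ?_, ?_⟩
  · have hex (F : CNF3) : ∃ t, Exec (prepareProg (enc ℓ) q) (inputStore F.input)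
        (inputStore (reducedCSP ℓ F).input) t := by
      obtain ⟨t, -, h⟩ := exec_prepareProg (i := F.input) (j := reduction (ℓ, F.encode))
        (hq (ℓ, F.encode)).2
      exact ⟨t, reducedCSP_input ℓ F ▸ h⟩
    constructor
    · rintro _ ⟨F, -, hF, rfl⟩
      obtain ⟨t, ht⟩ := hex F
      exact (hp.1 _ ⟨_, reducedCSP_val_eq_one hℓ hF, rfl⟩).trans (prOut_le_prOut_seq ht true)
    · rintro _ ⟨F, -, hF, rfl⟩
      obtain ⟨t, ht⟩ := hex F
      refine (hp.2 _ ⟨_, ?_, rfl⟩).trans (prOut_le_prOut_seq ht false)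
      have := reducedCSP_val_lt hℓ ε.coe_nonneg hF
      push_cast
      exact this
  · set γ : ℝ := 3 * C / (ℓ : ℝ) with hγ
    have hγ0 : 0 ≤ γ := by positivity
    set D : ℝ := strLen ℓ (manyClauses ℓ ^ 2) + 3 with hD
    have hD0 : 0 ≤ D := by positivity
    -- The exponent δ is split in halves: one absorbs the polynomial factor (n+1)^(2d), the other
    -- the power 2^(γdn) of the alphabet size.
    obtain ⟨K, hK0, hK⟩ := exists_pow_le_rpow (2 * d) (half_pos hδ)
    set M : ℝ := 4 * ℓ + 4 * (4 * C + 2) + 3 + 2 ^ D with hM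
    have hM0 : 0 ≤ M := by positivity
    set G : ℝ := |g (2 * ℓ)| with hG
    -- The three summands pay for the start-up, the reduction, and the run on the 2CSP instance; the
    -- first is absorbed because 2^(δn) ≥ 1.
    refine ⟨36 + 17 * (enc ℓ).size + A * M ^ d * K + |T (2 * ℓ)| * 2 ^ (G * D), fun F hF => ?_⟩
    set n := F.numVars with hn
    have hF' : (F.clauses.length : ℝ) ≤ C * n := by exact_mod_cast hF
    have hs : (alphExp (ℓ, F.encode) : ℝ) ≤ γ * n + D := by
      have h1 := alphExp_le ℓ F
      have h2 : 3 * (F.clauses.length : ℝ) / ℓ ≤ γ * n := by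
        rw [hγ, div_mul_eq_mul_div]
        exact div_le_div_of_nonneg_right (by linarith) (Nat.cast_nonneg _)
      linarith
    obtain ⟨t, ht, hexec⟩ := exec_prepareProg (i := F.input) (j := reduction (ℓ, F.encode))
      (hq (ℓ, F.encode)).2
    rw [← reducedCSP_input] at hexec
    refine HaltsWithin.seq hexec (hT _) ?_
    have hnum : (reducedCSP ℓ F).numVars = 2 * ℓ := length_verts _ _ _
    have halph : ((reducedCSP ℓ F).alphSize : ℝ) = 2 ^ (alphExp (ℓ, F.encode) : ℝ) := by
      rw [Real.rpow_natCast]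
      exact_mod_cast length_strings _
    have hone : (1 : ℝ) ≤ 2 ^ (δ * n) := Real.one_le_rpow (by norm_num) (by positivity)
    -- the running time on the instance of 2CSP
    have htime : T (2 * ℓ) * ((2 : ℝ) ^ (alphExp (ℓ, F.encode) : ℝ)) ^ g (2 * ℓ) ≤
        |T (2 * ℓ)| * 2 ^ (G * D) * 2 ^ (δ * n) := by
      rw [mul_assoc, ← Real.rpow_mul (by norm_num), ← Real.rpow_add (by norm_num)]
      refine mul_le_mul (le_abs_self _) (Real.rpow_le_rpow_of_exponent_le (by norm_num) ?_)
        (by positivity) (abs_nonneg _)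
      calc (alphExp (ℓ, F.encode) : ℝ) * g (2 * ℓ) ≤ (alphExp (ℓ, F.encode) : ℝ) * G := by
            gcongr; exact le_abs_self _
        _ ≤ (γ * n + D) * G := by gcongr
        _ = G * D + G * γ * n := by ring
        _ ≤ G * D + δ * n := by gcongr
    -- the running time of the reduction
    have hred : ((P.eval (sz (ℓ, F.encode) + 2 ^ alphExp (ℓ, F.encode)) : ℕ) : ℝ) ≤
        A * M ^ d * K * 2 ^ (δ * n) := by
      have h1 : (sz (ℓ, F.encode) : ℝ) ≤ (4 * ℓ + 4 * (4 * C + 2) + 3) * (n + 1) ^ 2 := by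
        have h2 : sz (ℓ, F.encode) ≤ 4 * ℓ + 4 * F.encode.length + 3 := by
          have := sz_bits_le F.encode
          rw [sz_prod, sz_nat]
          dsimp only
          omega
        have h3 := length_encode_le F
        have h4 : (F.encode.length : ℝ) ≤ n + 2 + F.clauses.length * (3 * n + 4) := by
          exact_mod_cast h3
        have h5 : (F.clauses.length : ℝ) * (3 * n + 4) ≤ C * n * (3 * n + 4) := by gcongr
        have h6 : (sz (ℓ, F.encode) : ℝ) ≤ 4 * ℓ + 4 * F.encode.length + 3 := by exact_mod_cast h2
        have h7 : (0 : ℝ) ≤ n := Nat.cast_nonneg _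
        have h8 : (0 : ℝ) ≤ C := Nat.cast_nonneg _
        have h9 : (0 : ℝ) ≤ ℓ := Nat.cast_nonneg _
        nlinarith [mul_nonneg h7 h7, mul_nonneg h8 h7, mul_nonneg h8 (mul_nonneg h7 h7),
          mul_nonneg h9 h7, mul_nonneg h9 (mul_nonneg h7 h7)]
      have h2 : ((2 : ℝ) ^ alphExp (ℓ, F.encode)) ≤ 2 ^ D * 2 ^ (γ * n) := by
        rw [← Real.rpow_natCast, ← Real.rpow_add (by norm_num)]
        exact Real.rpow_le_rpow_of_exponent_le (by norm_num) (by linarith)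
      have h3 : (1 : ℝ) ≤ 2 ^ (γ * n) := Real.one_le_rpow (by norm_num) (by positivity)
      have h4 : (1 : ℝ) ≤ (n + 1) ^ 2 := one_le_pow₀ (by simp)
      have h5 : (sz (ℓ, F.encode) : ℝ) + 2 ^ alphExp (ℓ, F.encode) ≤
          M * (n + 1) ^ 2 * 2 ^ (γ * n) := by
        calc _ ≤ (4 * ℓ + 4 * (4 * C + 2) + 3) * ((n : ℝ) + 1) ^ 2 * 1 + 2 ^ D * 1 * 2 ^ (γ * n) := by
              linarith
          _ ≤ (4 * ℓ + 4 * (4 * C + 2) + 3) * ((n : ℝ) + 1) ^ 2 * 2 ^ (γ * n) +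
              2 ^ D * (n + 1) ^ 2 * 2 ^ (γ * n) := by gcongr
          _ = _ := by ring
      have h6 := hA (sz (ℓ, F.encode) + 2 ^ alphExp (ℓ, F.encode))
        (Nat.le_add_right_of_le (sz_pos _))
      have h7 : ((P.eval (sz (ℓ, F.encode) + 2 ^ alphExp (ℓ, F.encode)) : ℕ) : ℝ) ≤
          A * ((sz (ℓ, F.encode) : ℝ) + 2 ^ alphExp (ℓ, F.encode)) ^ d := by exact_mod_cast h6
      refine h7.trans ?_
      calc A * ((sz (ℓ, F.encode) : ℝ) + 2 ^ alphExp (ℓ, F.encode)) ^ d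
          ≤ A * (M * (n + 1) ^ 2 * 2 ^ (γ * n)) ^ d := by gcongr
        _ = A * M ^ d * ((n + 1) ^ (2 * d) * 2 ^ (γ * d * n)) := by
          rw [mul_pow, mul_pow, ← pow_mul, ← Real.rpow_mul_natCast (by norm_num)]
          ring_nf
        _ ≤ A * M ^ d * (K * 2 ^ (δ / 2 * n) * 2 ^ (δ / 2 * n)) := by
          gcongr
          · exact hK n
          · norm_num
        _ = A * M ^ d * K * 2 ^ (δ * n) := by
          rw [mul_assoc K, ← Real.rpow_add (by norm_num)]
          ring_nf
    have ht' : (t : ℝ) ≤ 35 + 17 * (enc ℓ).size +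
        ((P.eval (sz (ℓ, F.encode) + 2 ^ alphExp (ℓ, F.encode)) : ℕ) : ℝ) := by exact_mod_cast ht
    rw [hnum, halph]
    have hc : (36 + 17 * ((enc ℓ).size : ℝ)) * 1 ≤ (36 + 17 * ((enc ℓ).size : ℝ)) * 2 ^ (δ * n) := by
      gcongr
    linarith

/-- Separating k from |Σ| turns a polynomial in the code length into a factor depending on k times a
fixed power of |Σ|. -/
theorem length_encode_twoCSP_add_one_le (I : TwoCSP) :
    (I.encode.length : ℝ) + 1 ≤ (4 * ((I.numVars : ℝ) + 1) ^ 2) * (I.alphSize : ℝ) ^ 2 := by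
  have hlen : I.encode.length = (I.numVars + 1) + ((I.alphSize + 1) +
      I.numVars * (I.numVars * (I.alphSize * I.alphSize + 1))) := by
    simp [TwoCSP.encode, TwoCSP.encodePair, unary, List.length_flatMap]
    ring
  have h1 : (1 : ℝ) ≤ I.alphSize := Nat.one_le_cast.2 I.alphSize_pos
  have h0 : (0 : ℝ) ≤ I.numVars := Nat.cast_nonneg _
  rw [hlen]
  push_cast
  have h2 : (I.alphSize : ℝ) ≤ (I.alphSize : ℝ) ^ 2 := by nlinarith
  have h3 : (1 : ℝ) ≤ (I.alphSize : ℝ) ^ 2 := by nlinarith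
  have h4 := mul_le_mul_of_nonneg_left h3 h0
  have h5 := mul_le_mul_of_nonneg_left h3 (mul_nonneg h0 h0)
  nlinarith [mul_nonneg h0 h0]

end GapPIH

theorem mainTheorem9 (hGapETH : GapPIH.GapETH) :
    (∃ ε : NNReal, 0 < ε ∧
      ∀ T : ℕ → ℕ, Computable T →
        ∀ g : ℕ → ℝ, g =o[Filter.atTop] (fun k : ℕ => (k : ℝ)) →
          ¬ ∃ p : GapPIH.Prog, GapPIH.Solves p (GapPIH.gap2CSP ε) ∧
            ∀ I : GapPIH.TwoCSP, GapPIH.HaltsWithin p I.input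
              ((T I.numVars : ℝ) * (I.alphSize : ℝ) ^ g I.numVars)) ∧
    GapPIH.PIH := by
  obtain ⟨ε, δ, C, hε, hδ, hETH⟩ := hGapETH
  have hε8 : 0 < ε / 8 := by positivity
  refine ⟨⟨ε / 8, hε8, ?_⟩, ε / 8, hε8, ?_⟩
  · rintro T - g hg ⟨p, hp, hT⟩
    exact GapPIH.not_solves_gap2CSP hδ hETH (fun k => T k) g hg p hp hT
  · rintro ⟨p, hp, f, c, -, hf⟩
    -- An FPT bound f(k)·(|x|+1)^c is at most a function of k times |Σ|^(2c), and the constant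
    -- exponent 2c is o(k).
    refine GapPIH.not_solves_gap2CSP hδ hETH (fun k => f k * (4 * ((k : ℝ) + 1) ^ 2) ^ c)
      (fun _ => 2 * c) ?_ p hp fun I => (hf I.encode I.numVars).mono ?_
    · exact Asymptotics.isLittleO_const_left.2
        (Or.inr (tendsto_norm_atTop_atTop.comp tendsto_natCast_atTop_atTop))
    · have h1 := GapPIH.length_encode_twoCSP_add_one_le I
      have h2 : (I.alphSize : ℝ) ^ (2 * (c : ℝ)) = ((I.alphSize : ℝ) ^ 2) ^ c := by
        rw [← pow_mul, ← Real.rpow_natCast]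
        push_cast
        rfl
      rw [h2, mul_assoc, ← mul_pow]
      gcongr
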